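/- All matroids are finite. For a matroid $M$, a set $S\subseteq E(M)$ and a new element $e\notin E(M)$, *freely placing $e$ in the flat spanned by $S$* means passing to the matroid $M'$ on $E(M)\cup\{e\}$ with $M'\setminus e=M$ in which a set $X\subseteq E(M)$ spans $e$ if and only if $X$ spans $S$. For distinct elements $a,b$ of $M$, let $M_{a\to b}$ be the matroid obtained from $M$ by freely placing a new element $c$ in the flat spanned by $\{a,b\}$, deleting $a$, and relabelling $c$ as $a$. Elements $p,q$ of $M$ are an *incomparable pair* if some subset of $E(M)\setminus\{p,q\}$ spans $p$ but not $q$, and some subset of $E(M)\setminus\{p,q\}$ spans $q$ but not $p$. An *excluded minor for $\mathbb F$-representability* is a matroid that is not $\mathbb F$-representable but all of whose proper minors are. Let $L$ and $N$ be matroids with disjoint ground sets, let $p\neq q$ be elements of $L$, and let $(A,B)$ be a partition of $E(N)$ into two bases of $N$. The matroid $M(L,p,q;N,A,B)$ is built as follows. Starting from $N\oplus L$, freely place new elements $a$ and $b$ in the flats spanned by $E(N)\cup\{p\}$ and $E(N)\cup\{q\}$, respectively; then, for each $x\in A$, freely place a new element $x_a$ in the flat spanned by $\{x,a\}$ and,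 for each $y\in B$, freely place a new element $y_b$ in the flat spanned by $\{y,b\}$. Next, delete all the elements of $E(N)$, and relabel $x_a$ as $x$ for each $x\in A$ and $y_b$ as $y$ for each $y\in B$. Finally, delete $p$ and $q$. **Theorem.** Let $\mathbb F$ be an infinite field. Suppose that - $L$ is an excluded minor for $\mathbb F$-representability, - $p,q$ is an incomparable pair of elements of $L$ such that $L_{p\to q}$ and $L_{q\to p}$ are both $\mathbb F$-representable, - $N$ is an $\mathbb F$-representable matroid with $E(N)\cap E(L)=\emptyset$, and - $(A,B)$ is a partition of $E(N)$ into two bases of $N$. Then, for every order in which the elements $x_a$ ($x\in A$) and then $y_b$ ($y\in B$) are placed, $M(L,p,q;N,A,B)$ is an excluded minor for $\mathbb F$-representability. -/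

import Mathlib

open Set

namespace Matroid

open scoped Matroid

universe u v

variable {α : Type u} {β : Type v}

/-- Independent sets of the matroid obtained from `M` by freely placing `e` in the flat `F`:
either an independent set of `M`, or `insert e I` where `I` is independent and does not span `F`.
(This is used for `e ∉ M.E` and for a flat `F` of `M`.) -/
def PlaceIndep (M : Matroid α) (F : Set α) (e : α) (I : Set α) : Prop :=
  M.Indep (I \ {e}) ∧ (e ∈ I → ¬ F ⊆ M.closure (I \ {e}))

lemma placeIndep_maximal (M : Matroid α) {F : Set α} {e : α} (X : Set α)
    (hX : X ⊆ insert e M.E) : ExistsMaximalSubsetProperty (M.PlaceIndep F e) X := by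
  intro I hI hIX
  have hYE : X \ {e} ⊆ M.E := by
    rintro x ⟨hx, hxe⟩
    exact (hX hx).resolve_left hxe
  obtain ⟨J, hJ, hIJ⟩ := hI.1.subset_isBasis_of_subset (sdiff_subset_sdiff_left hIX) hYE
  have heJ : e ∉ J := fun h ↦ (hJ.subset h).2 rfl
  have key : ∀ K : Set α, M.PlaceIndep F e K → K ⊆ X → J ⊆ K → K \ {e} = J := fun K hK hKX hJK ↦
    (hJ.eq_of_subset_indep hK.1 (subset_sdiff_singleton hJK heJ)
      (sdiff_subset_sdiff_left hKX)).symm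
  by_cases heX : e ∈ X
  swap
  · have hIe : I \ {e} = I := sdiff_singleton_eq_self (fun h ↦ heX (hIX h))
    refine ⟨J, hIe ▸ hIJ, ⟨⟨by simpa [sdiff_singleton_eq_self heJ] using hJ.indep,
      fun h ↦ (heJ h).elim⟩, hJ.subset.trans sdiff_subset⟩, ?_⟩
    rintro K ⟨hK, hKX⟩ hJK
    rw [← key K hK hKX hJK, sdiff_singleton_eq_self (fun h ↦ heX (hKX h))]
  by_cases hsp : F ⊆ M.closure (X \ {e})
  swap
  · have h1 : insert e J \ {e} = J := by simp [heJ]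
    refine ⟨insert e J, ?_, ⟨⟨by rw [h1]; exact hJ.indep, fun _ ↦ ?_⟩,
      insert_subset heX (hJ.subset.trans sdiff_subset)⟩, ?_⟩
    · rwa [← sdiff_singleton_subset_iff]
    · rwa [h1, hJ.closure_eq_closure]
    rintro K ⟨hK, hKX⟩ hJK
    rw [← key K hK hKX ((subset_insert _ _).trans hJK), insert_sdiff_singleton]
    exact subset_insert _ _
  by_cases heI : e ∈ I
  swap
  · have hIe : I \ {e} = I := sdiff_singleton_eq_self heI
    refine ⟨J, hIe ▸ hIJ, ⟨⟨by simpa [sdiff_singleton_eq_self heJ] using hJ.indep,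
      fun h ↦ (heJ h).elim⟩, hJ.subset.trans sdiff_subset⟩, ?_⟩
    rintro K ⟨hK, hKX⟩ hJK
    have hk := key K hK hKX hJK
    have : e ∉ K := fun h ↦ hK.2 h (by rwa [hk, hJ.closure_eq_closure])
    rw [← hk, sdiff_singleton_eq_self this]
  -- now `e ∈ I` and `X \ {e}` spans `F`
  obtain ⟨f, hfF, hf⟩ := not_subset.1 (hI.2 heI)
  have hfJ : f ∈ M.closure J := by rw [hJ.closure_eq_closure]; exact hsp hfF
  obtain ⟨j, hjJ, hjI, hj⟩ : ∃ j ∈ J, j ∉ I \ {e} ∧ f ∉ M.closure (J \ {j}) := by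
    by_cases hfJ' : f ∈ J
    · exact ⟨f, hfJ', fun h ↦ hf (M.subset_closure _ hI.1.subset_ground h),
        hJ.indep.notMem_closure_sdiff_of_mem hfJ'⟩
    have hC := hJ.indep.fundCircuit_isCircuit hfJ hfJ'
    by_contra! hcon
    have hsub : M.fundCircuit f J ⊆ insert f (I \ {e}) := by
      intro j hj
      by_cases hjf : j = f
      · exact Or.inl hjf
      have hjJ : j ∈ J := (M.fundCircuit_subset_insert f J hj).resolve_left hjf
      by_contra hjn
      have := hcon j hjJ (fun h ↦ hjn (Or.inr h))
      exact ((hJ.indep.mem_fundCircuit_iff hfJ hfJ').1 hj).not_dep <| by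
        rw [← insert_sdiff_singleton_comm (Ne.symm hjf)]
        exact (((hJ.indep.sdiff {j}).mem_closure_iff).1 this).resolve_right (fun h ↦ hfJ' h.1)
    exact hf <| M.closure_subset_closure
      (sdiff_singleton_subset_iff.2 hsub) (hC.mem_closure_sdiff_singleton_of_mem
        (M.mem_fundCircuit f J))
  have hje : j ≠ e := fun h ↦ heJ (h ▸ hjJ)
  have heJj : e ∉ J \ {j} := fun h ↦ heJ h.1
  have h1 : insert e (J \ {j}) \ {e} = J \ {j} := by simp [heJ]
  refine ⟨insert e (J \ {j}), ?_, ⟨⟨by rw [h1]; exact hJ.indep.sdiff _, fun _ h ↦ ?_⟩,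
      insert_subset heX (sdiff_subset.trans (hJ.subset.trans sdiff_subset))⟩, ?_⟩
  · rw [← sdiff_singleton_subset_iff]
    exact subset_sdiff_singleton hIJ hjI
  · rw [h1] at h
    exact hj (h hfF)
  rintro K ⟨hK, hKX⟩ hJK k hk
  by_contra hkn
  have hke : k ≠ e := fun h ↦ hkn (Or.inl h)
  have hkJ : k ∉ J \ {j} := fun h ↦ hkn (Or.inr h)
  refine hK.2 (hJK (mem_insert _ _)) ?_
  have hsub : J \ {j} ⊆ K \ {e} :=
    subset_sdiff_singleton ((subset_insert _ _).trans hJK) heJj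
  have hkcl : k ∈ M.closure (insert j (J \ {j})) := by
    rw [insert_sdiff_singleton, insert_eq_of_mem hjJ, hJ.closure_eq_closure]
    exact M.subset_closure _ hYE ⟨hKX hk, hke⟩
  have hkn' : k ∉ M.closure (J \ {j}) := fun h ↦
    (hK.1.notMem_closure_sdiff_of_mem ⟨hk, hke⟩)
      (M.closure_subset_closure (subset_sdiff_singleton hsub hkJ) h)
  have hjk := (M.closure_exchange ⟨hkcl, hkn'⟩).1
  refine hsp.trans ?_
  rw [← hJ.closure_eq_closure]
  refine M.closure_subset_closure_of_subset_closure fun x hx ↦ ?_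
  by_cases hxj : x = j
  · subst hxj
    exact M.closure_subset_closure (insert_subset (show k ∈ K \ {e} from ⟨hk, hke⟩) hsub) hjk
  · exact M.subset_closure _ hK.1.subset_ground (hsub ⟨hx, hxj⟩)

lemma placeIndep_aug (M : Matroid α) {F : Set α} {e : α} (hF : F ⊆ M.E) (he : e ∉ M.E)
    {I B : Set α} (hI : M.PlaceIndep F e I) (hInm : ¬ Maximal (M.PlaceIndep F e) I)
    (hB : Maximal (M.PlaceIndep F e) B) : ∃ x ∈ B \ I, M.PlaceIndep F e (insert x I) := by
  by_contra! H
  have hBE := hB.prop.1.subset_ground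
  have hIE := hI.1.subset_ground
  -- a witness of non-maximality
  obtain ⟨x, hxI, hx⟩ : ∃ x, x ∉ I ∧ M.PlaceIndep F e (insert x I) := by
    simp only [Maximal, hI, true_and, not_forall] at hInm
    obtain ⟨K, hK, hIK, hKI⟩ := hInm
    obtain ⟨x, hxK, hxI⟩ := not_subset.1 hKI
    have hsub := insert_subset hxK hIK
    exact ⟨x, hxI, hK.1.subset (sdiff_subset_sdiff_left hsub), fun h1 h2 ↦
      hK.2 (hsub h1) (h2.trans (M.closure_subset_closure (sdiff_subset_sdiff_left hsub)))⟩
  have hins : ∀ {y : α} (S : Set α), y ≠ e → insert y S \ {e} = insert y (S \ {e}) :=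
    fun S h ↦ (insert_sdiff_singleton_comm h S).symm
  -- extending `B` by an element of the ground set
  have hBx : ∀ y ∈ M.E, y ∉ M.closure (B \ {e}) → e ∈ B ∧ F ⊆ M.closure (insert y (B \ {e})) := by
    intro y hyE hy
    have hye : y ≠ e := fun h ↦ he (h ▸ hyE)
    have hyB : y ∉ B := fun h ↦ hy (M.subset_closure _ hBE ⟨h, hye⟩)
    by_contra hcon
    refine hyB (hB.le_of_ge (y := insert y B) ⟨?_, ?_⟩ (subset_insert _ _) (mem_insert _ _))
    · rw [hins _ hye, hB.prop.1.insert_indep_iff]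
      exact Or.inl ⟨hyE, hy⟩
    · rw [hins _ hye]
      exact fun h h2 ↦ hcon ⟨h.resolve_left hye.symm, h2⟩
  by_cases heI : e ∈ I
  · have hxe : x ≠ e := fun h ↦ hxI (h ▸ heI)
    have hx1 := hx.1
    have hx2 := hx.2 (Or.inr heI)
    rw [hins _ hxe] at hx1 hx2
    obtain ⟨f, hfF, hf⟩ := not_subset.1 hx2
    have hxE : x ∈ M.E := hx1.subset_ground (mem_insert _ _)
    have hfE := hF hfF
    have hxcl : x ∉ M.closure (I \ {e}) := by
      have := hx1.notMem_closure_sdiff_of_mem (mem_insert _ _)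
      rwa [insert_sdiff_self_of_notMem (fun h ↦ hxI h.1)] at this
    have hxf : x ∉ M.closure (insert f (I \ {e})) := fun h ↦ hf (M.closure_exchange ⟨h, hxcl⟩).1
    have hfI : f ∉ M.closure (I \ {e}) := fun h ↦
      hf (M.closure_subset_closure (subset_insert _ _) h)
    have hIf : M.closure (I \ {e}) ⊆ M.closure (insert f (I \ {e})) :=
      M.closure_subset_closure (subset_insert _ _)
    have hy : ∀ y ∈ B \ {e}, y ∉ M.closure (I \ {e}) → F ⊆ M.closure (insert y (I \ {e})) := by
      intro y hyB hyI
      have hyI' : y ∉ I := fun h ↦ hyI (M.subset_closure _ hIE ⟨h, hyB.2⟩)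
      have h1 := H y ⟨hyB.1, hyI'⟩
      simp only [PlaceIndep, hins I hyB.2, not_and, not_forall, not_not] at h1
      exact (h1 ((hI.1.insert_indep_iff).2 (Or.inl ⟨hBE hyB, hyI⟩))).2
    have hyf : B \ {e} ⊆ M.closure (insert f (I \ {e})) := by
      intro y hyB
      by_cases hyI : y ∈ M.closure (I \ {e})
      · exact hIf hyI
      · exact (M.closure_exchange ⟨hy y hyB hyI hfF, hfI⟩).1
    have hxB : x ∉ M.closure (B \ {e}) := fun h ↦
      hxf (M.closure_subset_closure_of_subset_closure hyf h)
    obtain ⟨heB, hFB⟩ := hBx x hxE hxB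
    obtain ⟨g, hgF, hg⟩ := not_subset.1 (hB.prop.2 heB)
    by_cases hall : B \ {e} ⊆ M.closure (I \ {e})
    · refine hx2 (hFB.trans (M.closure_subset_closure_of_subset_closure (insert_subset ?_ ?_)))
      · exact M.subset_closure _ hx1.subset_ground (mem_insert _ _)
      · exact hall.trans (M.closure_subset_closure (subset_insert _ _))
    · obtain ⟨y, hyB, hyI⟩ := not_subset.1 hall
      have hF' : F ⊆ M.closure (insert f (I \ {e})) :=
        (hy y hyB hyI).trans (M.closure_subset_closure_of_subset_closure (insert_subset (hyf hyB)
          ((subset_insert _ _).trans (M.subset_closure _ (insert_subset hfE hIE)))))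
      exact hxf (M.closure_subset_closure_of_subset_closure (insert_subset (hF' hgF) hyf)
        (M.closure_exchange ⟨hFB hgF, hg⟩).1)
  · have hIe : I \ {e} = I := sdiff_singleton_eq_self heI
    rw [hIe] at hIE
    have hII : M.Indep I := hIe ▸ hI.1
    have hBI : B \ {e} ⊆ M.closure I := by
      intro y hy
      by_contra hyI
      have hyI' : y ∉ I := fun h ↦ hyI (M.subset_closure _ hIE h)
      refine H y ⟨hy.1, hyI'⟩ ⟨?_, fun h ↦ (h.elim (fun h ↦ hy.2 h.symm) heI).elim⟩
      rw [hins _ hy.2, hIe, hII.insert_indep_iff]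
      exact Or.inl ⟨hBE hy, hyI⟩
    have hBI' := M.closure_subset_closure_of_subset_closure hBI
    by_cases heB : e ∈ B
    · have hFI : F ⊆ M.closure I := by
        by_contra hcon
        refine H e ⟨heB, heI⟩ ?_
        have h1 : insert e I \ {e} = I := by simp [heI]
        exact ⟨by rwa [h1], fun _ ↦ by rwa [h1]⟩
      have hxe : x ≠ e := by
        rintro rfl
        have h1 : insert x I \ {x} = I := by simp [heI]
        exact (h1 ▸ hx.2 (mem_insert _ _)) hFI
      have hx1 := hx.1
      rw [hins _ hxe, hIe] at hx1
      have hxE : x ∈ M.E := hx1.subset_ground (mem_insert _ _)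
      have hxcl : x ∉ M.closure I := by
        have := hx1.notMem_closure_sdiff_of_mem (mem_insert _ _)
        rwa [insert_sdiff_self_of_notMem hxI] at this
      obtain ⟨-, hFB⟩ := hBx x hxE (fun h ↦ hxcl (hBI' h))
      obtain ⟨g, hgF, hg⟩ := not_subset.1 (hB.prop.2 heB)
      exact hxcl (M.closure_subset_closure_of_subset_closure (insert_subset (hFI hgF) hBI)
        (M.closure_exchange ⟨hFB hgF, hg⟩).1)
    · have hsp : M.E ⊆ M.closure I := fun y hy ↦ hBI' <| by
        by_contra hcon
        exact heB (hBx y hy hcon).1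
      by_cases hxe : x = e
      · subst hxe
        have h1 : insert x I \ {x} = I := by simp [heI]
        exact (h1 ▸ hx.2 (mem_insert _ _)) (hF.trans hsp)
      have hx1 := hx.1
      rw [hins _ hxe, hIe] at hx1
      have := hx1.notMem_closure_sdiff_of_mem (mem_insert _ _)
      rw [insert_sdiff_self_of_notMem hxI] at this
      exact this (hsp (hx1.subset_ground (mem_insert _ _)))

/-- The matroid obtained from `M` by freely placing a new element `e ∉ M.E` in the flat spanned
by `S`, i.e. the principal extension of `M` into the flat `M.closure S`: an extension of `M` by `e`
in which a subset of `M.E` spans `e` if and only if it spans `S`; see `placeFreely_delete` and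
`mem_closure_placeFreely_iff`. (Should `e` already belong to `M`, it is deleted first.) -/
noncomputable def placeFreely (M : Matroid α) (S : Set α) (e : α) : Matroid α :=
  IndepMatroid.matroid
  { E := insert e (M ＼ {e}).E
    Indep := (M ＼ {e}).PlaceIndep ((M ＼ {e}).closure S) e
    indep_empty := by simp [PlaceIndep]
    indep_subset := fun I J hJ hIJ ↦ ⟨hJ.1.subset (sdiff_subset_sdiff_left hIJ), fun he h ↦
      hJ.2 (hIJ he) (h.trans (closure_subset_closure _ (sdiff_subset_sdiff_left hIJ)))⟩
    indep_aug := fun _ _ hI hIm hB ↦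
      placeIndep_aug _ (closure_subset_ground _ _) (by simp) hI hIm hB
    indep_maximal := placeIndep_maximal _
    subset_ground := fun I hI ↦ by
      rw [← sdiff_singleton_subset_iff]
      exact hI.1.subset_ground }

@[simp] lemma placeFreely_ground (M : Matroid α) (S : Set α) (e : α) :
    (M.placeFreely S e).E = insert e M.E := by
  simp [placeFreely]

lemma placeFreely_indep_iff (M : Matroid α) (S : Set α) {e : α} (he : e ∉ M.E) (I : Set α) :
    (M.placeFreely S e).Indep I ↔
      M.Indep (I \ {e}) ∧ (e ∈ I → ¬ M.closure S ⊆ M.closure (I \ {e})) := by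
  have h : M ＼ {e} = M := by simpa using he
  simp [placeFreely, PlaceIndep, h]

lemma placeFreely_delete (M : Matroid α) (S : Set α) {e : α} (he : e ∉ M.E) :
    M.placeFreely S e ＼ {e} = M := by
  refine ext_indep (by simp [he]) fun I hI ↦ ?_
  have heI : e ∉ I := fun h ↦ (hI h).2 rfl
  simp [delete_indep_iff, placeFreely_indep_iff M S he, heI]

/-- A subset `X` of `M.E` spans the new element if and only if it spans `S`. -/
lemma mem_closure_placeFreely_iff (M : Matroid α) {S : Set α} {e : α} (he : e ∉ M.E)
    (hS : S ⊆ M.E) {X : Set α} (hX : X ⊆ M.E) :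
    e ∈ (M.placeFreely S e).closure X ↔ S ⊆ M.closure X := by
  obtain ⟨I, hI⟩ := M.exists_isBasis X
  have heX : e ∉ X := fun h ↦ he (hX h)
  have heI : e ∉ I := fun h ↦ heX (hI.subset h)
  have hI' : (M.placeFreely S e).IsBasis I X := by
    rw [← placeFreely_delete M S he, delete_isBasis_iff] at hI
    exact hI.1
  rw [← hI'.closure_eq_closure, ← hI.closure_eq_closure, hI'.indep.mem_closure_iff_of_notMem heI,
    dep_iff, placeFreely_indep_iff M S he]
  have h1 : insert e I \ {e} = I := by simp [heI]
  have h2 : insert e I ⊆ insert e M.E := insert_subset_insert hI.indep.subset_ground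
  simp only [h1, hI.indep, true_and, mem_insert, forall_const, not_not, placeFreely_ground, h2,
    and_true]
  exact closure_subset_closure_iff_subset_closure hS

/-- `M` with the element `a` moved freely towards `b`: freely place a new element `c` in the
flat spanned by `{a, b}`, delete `a`, and relabel `c` as `a`. The new element `c` is the element
`none` of `Option α`. -/
noncomputable def moveTowards (M : Matroid α) (a b : α) : Matroid α :=
  open Classical in
  (((M.mapEmbedding Function.Embedding.some).placeFreely {some a, some b} none) ＼ {some a}).comap
    (Function.update some a none)

@[simp] lemma moveTowards_ground (M : Matroid α) {a b : α} (ha : a ∈ M.E) :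
    (M.moveTowards a b).E = M.E := by
  ext x
  by_cases hx : x = a
  · subst hx
    simp [moveTowards, ha]
  · simp [moveTowards, hx]

/-- `p` and `q` are an incomparable pair of elements of `M`: some set avoiding `p` and `q` spans
`p` but not `q`, and some such set spans `q` but not `p`. -/
def IncomparablePair (M : Matroid α) (p q : α) : Prop :=
  p ∈ M.E ∧ q ∈ M.E ∧
  (∃ Y ⊆ M.E \ {p, q}, p ∈ M.closure Y ∧ q ∉ M.closure Y) ∧
  (∃ Y ⊆ M.E \ {p, q}, q ∈ M.closure Y ∧ p ∉ M.closure Y)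

/-- A (finite) matroid `M` is representable over `F`: it is the matroid of the columns, indexed
by the elements of `M`, of a matrix over `F`. -/
def RepresentableOver (M : Matroid α) (F : Type*) [Field F] : Prop :=
  ∃ (n : ℕ) (v : α → Fin n → F), ∀ I ⊆ M.E, M.Indep I ↔ LinearIndepOn F v I

/-- A finite matroid that is not `F`-representable, while all of its proper minors are. -/
def IsExcludedMinorFor (M : Matroid α) (F : Type*) [Field F] : Prop :=
  M.Finite ∧ ¬ M.RepresentableOver F ∧ ∀ M', M' <m M → M'.RepresentableOver F

/-- The elements used in the construction: those of `L`, those of `N`, the two new elements `a` and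
`b`, and, for each element `x` of `N`, a new element `lift x` (called `x_a` if `x ∈ A`
and `x_b` if `x ∈ B`). -/
inductive Elt (α : Type u) (β : Type v) : Type (max u v)
  | ofL (e : α)
  | ofN (x : β)
  | a
  | b
  | lift (x : β)

namespace Elt

/-- The relabelling that exchanges the names of `x` and `lift x`, for each `x` of `N`. -/
def swapLift : Elt α β ≃ Elt α β where
  toFun
    | ofL e => ofL e
    | ofN x => lift x
    | a => a
    | b => b
    | lift x => ofN x
  invFun
    | ofL e => ofL e
    | ofN x => lift x
    | a => a
    | b => b
    | lift x => ofN x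
  left_inv := by rintro (_ | _ | _ | _ | _) <;> rfl
  right_inv := by rintro (_ | _ | _ | _ | _) <;> rfl

/-- The inclusion of the elements of `N` and `L`. -/
def ofSum : β ⊕ α ↪ Elt α β where
  toFun := Sum.elim ofN ofL
  inj' := by rintro (_ | _) (_ | _) h <;> simp_all

end Elt

/-- For each `x` in the list `l`, in turn, freely place `lift x` in the flat spanned
by `{x, c}`. -/
noncomputable def placeLifts (M : Matroid (Elt α β)) (c : Elt α β) (l : List β) : Matroid (Elt α β) :=
  l.foldl (fun M' x ↦ M'.placeFreely {Elt.ofN x, c} (Elt.lift x)) M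

/-- First stage of the construction: from `N ⊕ L`, freely place `a` and `b` in the flats spanned by
`E(N) ∪ {p}` and `E(N) ∪ {q}`, then freely place `x_a` in the flat spanned by `{x, a}` for each
`x ∈ A` and `y_b` in the flat spanned by `{y, b}` for each `y ∈ B`. -/
noncomputable def construction₁ (L : Matroid α) (p q : α) (N : Matroid β) (A B : List β) :
    Matroid (Elt α β) :=
  placeLifts (placeLifts
    ((((N.sum L).mapEmbedding Elt.ofSum).placeFreely
        (insert (Elt.ofL p) (Elt.ofN '' N.E)) Elt.a).placeFreely
        (insert (Elt.ofL q) (Elt.ofN '' N.E)) Elt.b)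
    Elt.a A) Elt.b B

/-- Second stage: delete each element `x` of `N` and relabel `lift x` as `x`. -/
noncomputable def construction₂ (L : Matroid α) (p q : α) (N : Matroid β) (A B : List β) :
    Matroid (Elt α β) :=
  (construction₁ L p q N A B ＼ (Elt.ofN '' N.E)).mapEquiv Elt.swapLift

/-- The matroid `M(L, p, q; N, A, B)`. The sets `A` and `B` are given by lists, which fix the order
in which the elements of the first stage are placed. -/
noncomputable def construction (L : Matroid α) (p q : α) (N : Matroid β) (A B : List β) :
    Matroid (Elt α β) :=
  construction₂ L p q N A B ＼ {Elt.ofL p, Elt.ofL q}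

end Matroid

namespace Matroid

open scoped Matroid

open Submodule

/-! ### Representations by vectors in arbitrary spaces -/

section Representations

variable {F : Type*} [Field F] {V : Type*} [AddCommGroup V] [Module F V]
  {V' : Type*} [AddCommGroup V'] [Module F V'] {α β : Type*} {M : Matroid α}

/-! Write `M` for the constructed matroid and `r` for the rank of `N`. Everything rests on one
combinatorial description of the independent sets of `M`. A freely placed element can be added to an
independent set exactly when some member of the set it was placed in can be added in its stead
(`placeFreely_indep_insert_iff`). Unwinding all placements, each element of `A` is replaced by its
original in `N`, except that at most one may be replaced by `a`, and only if `a` is not already in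
use; then `a` is replaced by `p` or by a spare element of `N`. The same holds for `B`, `b` and `q`.
Since `N` has room for exactly `r` elements, what remains is a count, recorded in `SplitIndep` and
proved in `construction_indep_iff`.

Minors. Free placement preserves representability over an infinite field, so a representable matroid
in place of `L` yields a representable construction. Removing an element of `L` from `M` amounts to
removing it from `L`, which leaves a representable matroid. For the other elements,
`splitIndep_moveTowards_iff` shows that replacing `L` by `L_{p→q}` affects only sets that contain `A
∪ {a}` and avoid `B ∪ {b}`. Hence deleting an element of `A ∪ {a}`, or contracting one of `B ∪ {b}`,
cannot distinguish `L` from the representable matroid `L_{p→q}`; the remaining cases use `L_{q→p}`.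

Nonrepresentability. Suppose vectors represent `M`, and let `UA` and `UB` be the spans of `A ∪ {a}`
and `B ∪ {b}`. Both are hyperplanes of one space of dimension `r + 2`, and a set of elements of `L`
other than `p` and `q` is independent together with `p` exactly when it is independent and its span
avoids `UA`; likewise for `q` and `UB`. Modulo `UA ∩ UB` these subspaces become the lines through
`a` and `b`, so the quotient represents `L` with `a` as `p` and `b` as `q`, unless some independent
set avoiding `p` and `q` spans a nonzero vector of `UA ∩ UB`. Incomparability excludes this
(`IncomparablePair.represents_mkQ`), so `L` would be representable. -/

lemma linearIndepOn_image_iff {v : β → V} {f : α → β} {s : Set α} (hf : InjOn f s) :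
    LinearIndepOn F v (f '' s) ↔ LinearIndepOn F (v ∘ f) s :=
  ⟨fun h ↦ h.comp_of_image hf, fun h ↦ h.image_of_comp⟩

/-- The independent sets of `M` are those on which the family of vectors `v` is independent. -/
def Represents (F : Type*) [Field F] {V : Type*} [AddCommGroup V] [Module F V] {α : Type*}
    (M : Matroid α) (v : α → V) : Prop :=
  ∀ I ⊆ M.E, M.Indep I ↔ LinearIndepOn F v I

lemma Represents.representableOver [FiniteDimensional F V] {v : α → V}
    (h : M.Represents F v) : M.RepresentableOver F := by
  let φ : V ≃ₗ[F] (Fin (Module.finrank F V) → F) := (Module.finBasis F V).equivFun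
  refine ⟨_, φ ∘ v, fun I hI ↦ (h I hI).trans ?_⟩
  exact (φ.toLinearMap.linearIndepOn_iff_of_injOn φ.injective.injOn).symm

lemma Represents.mem_closure_iff {v : α → V} (h : M.Represents F v) {X : Set α} (hX : X ⊆ M.E)
    {e : α} (he : e ∈ M.E) : e ∈ M.closure X ↔ v e ∈ span F (v '' X) := by
  obtain ⟨I, hI⟩ := M.exists_isBasis X
  have key : ∀ {x}, x ∈ M.E → (x ∈ M.closure I ↔ v x ∈ span F (v '' I)) := by
    intro x hx
    have hIv := (h I hI.indep.subset_ground).1 hI.indep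
    rw [hI.indep.mem_closure_iff', and_iff_right hx, h _ (insert_subset hx hI.indep.subset_ground),
      hIv.mem_span_iff]
  have hsp : span F (v '' X) = span F (v '' I) := by
    refine le_antisymm (span_le.2 ?_) (span_mono (image_mono hI.subset))
    rintro _ ⟨x, hx, rfl⟩
    exact (key (hX hx)).1 (hI.subset_closure hx)
  rw [← hI.closure_eq_closure, hsp, key he]

lemma RepresentableOver.of_injOn {N : Matroid β} (hN : N.RepresentableOver F) (f : α → β)
    (hf : InjOn f M.E) (hE : MapsTo f M.E N.E)
    (h : ∀ I ⊆ M.E, M.Indep I ↔ N.Indep (f '' I)) : M.RepresentableOver F := by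
  obtain ⟨n, v, hv⟩ := hN
  refine ⟨n, v ∘ f, fun I hI ↦ ?_⟩
  rw [h I hI, hv _ ((hE.mono_left hI).image_subset), linearIndepOn_image_iff (hf.mono hI)]

lemma RepresentableOver.mapEmbedding (hM : M.RepresentableOver F) (f : α ↪ β) :
    (M.mapEmbedding f).RepresentableOver F := by
  obtain ⟨n, v, hv⟩ := hM
  rcases isEmpty_or_nonempty α with hα | hα
  · refine ⟨n, fun _ ↦ 0, fun I hI ↦ ?_⟩
    obtain rfl : I = ∅ := by
      rw [mapEmbedding_ground_eq, M.E.eq_empty_of_isEmpty, image_empty] at hI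
      exact subset_empty_iff.1 hI
    simp
  refine ⟨n, v ∘ Function.invFun f, fun I hI ↦ ?_⟩
  obtain ⟨J, hJ, rfl⟩ := subset_image_iff.1 hI
  rw [linearIndepOn_image_iff f.injective.injOn, Function.comp_assoc,
    Function.invFun_comp f.injective, Function.comp_id, ← hv J hJ]
  simp [preimage_image_eq _ f.injective]

lemma RepresentableOver.mapEquiv (hM : M.RepresentableOver F) (f : α ≃ β) :
    (M.mapEquiv f).RepresentableOver F :=
  hM.mapEmbedding f.toEmbedding

lemma RepresentableOver.sum {N : Matroid β} (hM : M.RepresentableOver F)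
    (hN : N.RepresentableOver F) : (M.sum N).RepresentableOver F := by
  obtain ⟨m, v, hv⟩ := hM
  obtain ⟨n, w, hw⟩ := hN
  refine Represents.representableOver (V := (Fin m → F) × (Fin n → F))
    (v := Sum.elim (LinearMap.inl F _ _ ∘ v) (LinearMap.inr F _ _ ∘ w)) fun I hI ↦ ?_
  have hIu : I = Sum.inl '' (Sum.inl ⁻¹' I) ∪ Sum.inr '' (Sum.inr ⁻¹' I) := by
    ext (x | x) <;> simp
  have h1 : Sum.inl ⁻¹' I ⊆ M.E := fun x hx ↦ by simpa using hI hx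
  have h2 : Sum.inr ⁻¹' I ⊆ N.E := fun x hx ↦ by simpa using hI hx
  have hdj : Disjoint (Sum.inl '' (Sum.inl ⁻¹' I)) (Sum.inr '' (Sum.inr ⁻¹' I)) := by
    rw [disjoint_left]
    rintro _ ⟨x, -, rfl⟩ ⟨y, -, h⟩
    cases h
  rw [sum_indep_iff, hv _ h1, hw _ h2]
  conv_rhs => rw [hIu, linearIndepOn_union_iff hdj,
    linearIndepOn_image_iff Sum.inl_injective.injOn,
    linearIndepOn_image_iff Sum.inr_injective.injOn, Sum.elim_comp_inl, Sum.elim_comp_inr,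
    LinearMap.linearIndepOn_iff_of_injOn _ LinearMap.inl_injective.injOn,
    LinearMap.linearIndepOn_iff_of_injOn _ LinearMap.inr_injective.injOn]
  refine and_congr_right fun _ ↦ (and_iff_left ?_).symm
  refine Disjoint.mono (b := LinearMap.range (LinearMap.inl F (Fin m → F) (Fin n → F)))
    (d := LinearMap.range (LinearMap.inr F (Fin m → F) (Fin n → F))) ?_ ?_
    LinearMap.disjoint_inl_inr
  · rw [span_le]
    rintro _ ⟨_, ⟨x, -, rfl⟩, rfl⟩
    exact ⟨v x, rfl⟩
  · rw [span_le]
    rintro _ ⟨_, ⟨x, -, rfl⟩, rfl⟩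
    exact ⟨w x, rfl⟩

lemma RepresentableOver.delete (hM : M.RepresentableOver F) (D : Set α) :
    (M ＼ D).RepresentableOver F := by
  obtain ⟨n, v, hv⟩ := hM
  refine ⟨n, v, fun I hI ↦ ?_⟩
  rw [delete_indep_iff, and_iff_left (subset_sdiff.1 hI).2, hv I (subset_sdiff.1 hI).1]

lemma RepresentableOver.contract (hM : M.RepresentableOver F) (C : Set α) :
    (M ／ C).RepresentableOver F := by
  obtain ⟨n, v, hv⟩ := hM
  obtain ⟨I, hI⟩ := M.exists_isBasis' C
  refine Represents.representableOver (v := mkQ (span F (v '' I)) ∘ v) fun J hJ ↦ ?_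
  obtain ⟨hJE, hJC⟩ := subset_sdiff.1 hJ
  have hIv := (hv I hI.indep.subset_ground).1 hI.indep
  rw [hI.contract_indep_iff, and_iff_left hJC.symm, union_comm,
    hIv.quotient_iff_union (hJC.symm.mono_left hI.subset),
    hv _ (union_subset hI.indep.subset_ground hJE)]

lemma RepresentableOver.of_isMinor {N : Matroid α} (hM : M.RepresentableOver F) (h : N ≤m M) :
    N.RepresentableOver F := by
  obtain ⟨C, D, rfl⟩ := h
  exact (hM.contract C).delete D

/-- A generic vector of the span of `S` represents the new element: it has to avoid the finitely
many spans of subsets of `M.E` that do not contain the whole span of `S`. -/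
lemma RepresentableOver.placeFreely [Infinite F] [M.Finite] (hM : M.RepresentableOver F)
    (S : Set α) (e : α) : (M.placeFreely S e).RepresentableOver F := by
  classical
  wlog he : e ∉ M.E generalizing M with H
  · have h1 : (M ＼ {e}).placeFreely S e = M.placeFreely S e := by
      simp [Matroid.placeFreely, delete_delete]
    rw [← h1]
    exact H (hM.delete {e}) (by simp)
  obtain ⟨n, v, hv⟩ := hM
  have hv : M.Represents F v := hv
  set U := span F (v '' (S ∩ M.E)) with hU
  have hcl : ∀ X ⊆ M.E, M.closure S ⊆ M.closure X ↔ U ≤ span F (v '' X) := by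
    intro X hX
    rw [← M.closure_inter_ground S, closure_subset_closure_iff_subset_closure, hU, span_le,
      image_subset_iff]
    exact forall₂_congr fun x hx ↦ hv.mem_closure_iff hX hx.2
  have hfin : {X | X ⊆ M.E}.Finite := M.ground_finite.finite_subsets
  obtain ⟨w, hwU, hw⟩ : ∃ w ∈ U, ∀ X ⊆ M.E, w ∈ span F (v '' X) → U ≤ span F (v '' X) := by
    -- The traces on `U` of these spans, other than `U` itself, are finitely many proper subspaces,
    -- and such subspaces cannot cover `U` over an infinite field.
    have hs := Subspace.biUnion_ne_univ_of_top_notMem (k := F) (E := U)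
      (s := (hfin.toFinset.image fun X ↦ (span F (v '' X)).comap U.subtype).erase ⊤) (by simp)
    obtain ⟨w, hw⟩ := (ne_univ_iff_exists_notMem _).1 hs
    refine ⟨w, w.2, fun X hX hwX ↦ ?_⟩
    by_contra hcon
    refine hw (mem_biUnion (x := (span F (v '' X)).comap U.subtype) ?_ hwX)
    simp only [Finset.coe_erase, Finset.coe_image, Finite.coe_toFinset, mem_sdiff, mem_image,
      mem_singleton_iff]
    refine ⟨⟨X, hX, rfl⟩, ?_⟩
    rwa [Submodule.comap_subtype_eq_top]
  have hup : ∀ X ⊆ M.E, EqOn (Function.update v e w) v X := fun X hX x hx ↦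
    Function.update_of_ne (by rintro rfl; exact he (hX hx)) _ _
  refine ⟨n, Function.update v e w, fun I hI ↦ ?_⟩
  rw [placeFreely_ground] at hI
  have hIE : I \ {e} ⊆ M.E := by simpa using hI
  have h1 := hup _ hIE
  rw [placeFreely_indep_iff _ _ he, hcl _ hIE, hv _ hIE, ← linearIndepOn_congr h1]
  by_cases heI : e ∈ I
  · conv_rhs => rw [← insert_sdiff_self_of_mem heI, linearIndepOn_insert (by simp)]
    rw [h1.image_eq, Function.update_self]
    refine and_congr_right fun _ ↦ ⟨fun h h' ↦ h heI (hw _ hIE h'), fun h _ h' ↦ h (h' hwU)⟩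
  · simp [heI]

/-- Representability passes to minors, so this reduces the excluded-minor condition to
single-element deletions and contractions. -/
lemma isStrictMinor_singleton {N : Matroid α} (h : N <m M) :
    ∃ e ∈ M.E, N ≤m M ＼ {e} ∨ N ≤m M ／ {e} := by
  obtain ⟨C, D, hC, hD, hCD, rfl⟩ := h.isMinor.exists_eq_contract_delete_disjoint
  rcases C.eq_empty_or_nonempty with rfl | ⟨e, he⟩
  · rcases D.eq_empty_or_nonempty with rfl | ⟨e, he⟩
    · simp [isStrictMinor_irrefl] at h
    · refine ⟨e, hD he, Or.inl ⟨∅, D, ?_⟩⟩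
      rw [contract_empty, contract_empty, delete_delete, singleton_union, insert_eq_of_mem he]
  · refine ⟨e, hC he, Or.inr ⟨C, D, ?_⟩⟩
    rw [contract_contract, singleton_union, insert_eq_of_mem he]

end Representations

/-! ### Independent sets of the construction -/

section Construction

variable {α β : Type*}

/-- The replacement principle behind all later independence criteria: an independent `K` fails to
span `S` exactly when some member of `S` extends it. -/
lemma placeFreely_indep_insert_iff {M : Matroid α} {S K : Set α} {e : α} (he : e ∉ M.E)
    (hS : S ⊆ M.E) (heK : e ∉ K) :
    (M.placeFreely S e).Indep (insert e K) ↔ ∃ s ∈ S, s ∉ K ∧ M.Indep (insert s K) := by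
  rw [placeFreely_indep_iff _ _ he, insert_sdiff_self_of_notMem heK,
    closure_subset_closure_iff_subset_closure]
  simp only [mem_insert_iff, true_or, true_imp_iff, not_subset]
  constructor
  · rintro ⟨hK, s, hs, hsK⟩
    exact ⟨s, hs, fun h ↦ hsK (M.subset_closure K hK.subset_ground h),
      hK.insert_indep_iff.2 (Or.inl ⟨hS hs, hsK⟩)⟩
  · rintro ⟨s, hs, hsK, h⟩
    refine ⟨h.subset (subset_insert _ _), s, hs, ?_⟩
    simpa [insert_sdiff_self_of_notMem hsK] using h.notMem_closure_sdiff_of_mem (mem_insert s K)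

lemma placeFreely_indep_iff_of_notMem {M : Matroid α} {S K : Set α} {e : α} (he : e ∉ M.E)
    (heK : e ∉ K) : (M.placeFreely S e).Indep K ↔ M.Indep K := by
  rw [placeFreely_indep_iff _ _ he, sdiff_singleton_eq_self heK]
  simp [heK]

lemma placeLifts_cons (M : Matroid (Elt α β)) (c : Elt α β) (x : β) (l : List β) :
    M.placeLifts c (x :: l) = (M.placeFreely {Elt.ofN x, c} (Elt.lift x)).placeLifts c l := rfl

lemma placeLifts_ground (M : Matroid (Elt α β)) (c : Elt α β) (l : List β) :
    (M.placeLifts c l).E = M.E ∪ Elt.lift '' {x | x ∈ l} := by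
  induction l generalizing M with
  | nil => simp [placeLifts]
  | cons x l ih =>
    rw [placeLifts_cons, ih, placeFreely_ground]
    ext y
    simp only [mem_union, mem_insert_iff, mem_image, mem_ofPred_eq, List.mem_cons]
    grind

/-- Each lift is replaced by its original or by `c`, and `c` can be used only once; so either no
lift goes to `c`, or exactly one does and `c` was free. -/
lemma placeLifts_indep_iff' {M : Matroid (Elt α β)} {c : Elt α β} {l : List β} (hl : l.Nodup)
    (hlM : ∀ x ∈ l, Elt.ofN x ∈ M.E) (hlM' : ∀ x ∈ l, Elt.lift x ∉ M.E) (hc : c ∈ M.E)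
    (hcN : ∀ x, c ≠ Elt.ofN x) (hcl : ∀ x, c ≠ Elt.lift x) {J : Set (Elt α β)} {T : Set β}
    (hJ : ∀ x ∈ l, Elt.lift x ∉ J) (hT : ∀ x ∈ T, x ∈ l) (hTJ : ∀ x ∈ T, Elt.ofN x ∉ J) :
    (M.placeLifts c l).Indep (J ∪ Elt.lift '' T) ↔ M.Indep (J ∪ Elt.ofN '' T) ∨
      ∃ y ∈ T, c ∉ J ∧ M.Indep (insert c (J ∪ Elt.ofN '' (T \ {y}))) := by
  induction l generalizing M J T with
  | nil =>
    obtain rfl : T = ∅ := eq_empty_of_forall_notMem fun x hx ↦ by simpa using hT x hx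
    simp [placeLifts]
  | cons x l ih =>
    obtain ⟨hxl, hl⟩ := List.nodup_cons.1 hl
    have hx : Elt.lift x ∉ M.E := hlM' x (by simp)
    have hS : {Elt.ofN x, c} ⊆ M.E := insert_subset (hlM x (by simp)) (singleton_subset_iff.2 hc)
    have hM1 : ∀ y ∈ l, Elt.ofN y ∈ (M.placeFreely {Elt.ofN x, c} (Elt.lift x)).E := by
      intro y hy
      rw [placeFreely_ground]
      exact Or.inr (hlM y (by simp [hy]))
    have hM2 : ∀ y ∈ l, Elt.lift y ∉ (M.placeFreely {Elt.ofN x, c} (Elt.lift x)).E := by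
      intro y hy
      rw [placeFreely_ground]
      rintro (h | h)
      · cases h
        exact hxl hy
      · exact hlM' y (by simp [hy]) h
    have hc' : c ∈ (M.placeFreely {Elt.ofN x, c} (Elt.lift x)).E := by
      rw [placeFreely_ground]
      exact Or.inr hc
    have hxJ : Elt.lift x ∉ J := hJ x (by simp)
    rw [placeLifts_cons]
    by_cases hxT : x ∈ T
    -- The head `lift x` counts as part of `J` while the tail is treated by induction, and is itself
    -- replaced afterwards.
    · have h1 : J ∪ Elt.lift '' T = insert (Elt.lift x) J ∪ Elt.lift '' (T \ {x}) := by
        conv_lhs => rw [← insert_sdiff_self_of_mem hxT, image_insert_eq]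
        rw [union_insert, insert_union]
      rw [h1, ih hl hM1 hM2 hc' (by grind) (by grind) (by grind)]
      have h2 : ∀ U : Set β, insert (Elt.lift x) J ∪ Elt.ofN '' U =
        insert (Elt.lift x) (J ∪ Elt.ofN '' U) := fun U ↦ insert_union ..
      have h3 : ∀ U : Set β, insert c (insert (Elt.lift x) (J ∪ Elt.ofN '' U)) =
          insert (Elt.lift x) (insert c (J ∪ Elt.ofN '' U)) := fun U ↦ insert_comm ..
      have h4 : ∀ U : Set β, Elt.lift x ∉ J ∪ Elt.ofN '' U := by simp [hxJ]
      have h5 : ∀ U : Set β, Elt.lift x ∉ insert c (J ∪ Elt.ofN '' U) := fun U ↦ by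
        simp [hxJ, (hcl x).symm]
      have h6 : ∀ U ⊆ T, x ∈ U → insert (Elt.ofN x) (J ∪ Elt.ofN '' (U \ {x})) =
          J ∪ Elt.ofN '' U := fun U _ hU ↦ by
        conv_rhs => rw [← insert_sdiff_self_of_mem hU, image_insert_eq]
        rw [union_insert]
      have h7 : ∀ U : Set β, c ∈ J ∪ Elt.ofN '' U ↔ c ∈ J := fun U ↦ by
        simp [fun x ↦ (hcN x).symm]
      have h8 : ∀ U : Set β, x ∉ U → Elt.ofN x ∉ J ∪ Elt.ofN '' U := fun U hU ↦ by
        simp [hTJ x hxT, hU]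
      have h9 : c ∉ insert (Elt.lift x) J ↔ c ∉ J := by simp [hcl x]
      simp only [h2, h3, h9]
      rw [placeFreely_indep_insert_iff hx hS (h4 _)]
      simp only [placeFreely_indep_insert_iff hx hS (h5 _)]
      simp only [mem_insert_iff, mem_singleton_iff, exists_eq_or_imp, exists_eq_left, true_or,
        not_true_eq_false, false_and, or_false, h7, h8 (T \ {x}) (by simp), not_false_eq_true,
        true_and, h6 T subset_rfl hxT]
      -- The lift sent to `c` is either the head or one of the tail; in the latter case `c` is
      -- taken, so the head must go to `ofN x`.
      constructor
      · rintro ((h | h) | ⟨y, hy, hcJ, -, h⟩)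
        · exact Or.inl h
        · exact Or.inr ⟨x, hxT, h⟩
        · refine Or.inr ⟨y, hy.1, hcJ, ?_⟩
          rwa [Set.sdiff_sdiff_comm, insert_comm, h6 _ sdiff_subset ⟨hxT, fun h ↦ hy.2 (Eq.symm h)⟩] at h
      · rintro (h | ⟨y, hyT, hcJ, h⟩)
        · exact Or.inl (Or.inl h)
        obtain rfl | hyx := eq_or_ne y x
        · exact Or.inl (Or.inr ⟨hcJ, h⟩)
        · refine Or.inr ⟨y, ⟨hyT, hyx⟩, hcJ, ?_, ?_⟩
          · rw [not_or]
            exact ⟨(hcN x).symm, h8 _ (by simp)⟩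
          · rwa [Set.sdiff_sdiff_comm, insert_comm, h6 _ sdiff_subset ⟨hxT, hyx.symm⟩]
    · rw [ih hl hM1 hM2 hc' (by grind) (by grind) (by grind)]
      rw [placeFreely_indep_iff_of_notMem hx (by simp [hxJ])]
      refine or_congr_right (exists_congr fun y ↦ and_congr_right fun _ ↦ and_congr_right fun _ ↦ ?_)
      rw [placeFreely_indep_iff_of_notMem hx (by simp [hxJ, (hcl x).symm])]

/-- Independence after placing lifts: all but at most one of the lifts `lift x` are replaced by
`x`, and the remaining one by `c`, which is then not available for any other purpose. -/
lemma placeLifts_indep_iff {M : Matroid (Elt α β)} {c : Elt α β} {l : List β} (hl : l.Nodup)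
    (hlM : ∀ x ∈ l, Elt.ofN x ∈ M.E) (hlM' : ∀ x ∈ l, Elt.lift x ∉ M.E) (hc : c ∈ M.E)
    (hcN : ∀ x, c ≠ Elt.ofN x) (hcl : ∀ x, c ≠ Elt.lift x) {J D : Set (Elt α β)} {T : Set β}
    (hJ : ∀ x ∈ l, Elt.lift x ∉ J) (hT : ∀ x ∈ T, x ∈ l) (hTJ : ∀ x ∈ T, Elt.ofN x ∉ J)
    (hcJ : c ∉ J) (hD : D ⊆ {c}) :
    (M.placeLifts c l).Indep (J ∪ D ∪ Elt.lift '' T) ↔ ∃ T₁ ⊆ T, ∃ C ⊆ {c},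
      T₁.ncard + C.ncard = T.ncard + D.ncard ∧ M.Indep (J ∪ C ∪ Elt.ofN '' T₁) := by
  have hTfin : T.Finite := l.finite_toSet.subset hT
  rw [placeLifts_indep_iff' hl hlM hlM' hc hcN hcl (by grind) hT (by grind)]
  obtain rfl | rfl := subset_singleton_iff_eq.1 hD
  · simp only [union_empty, ncard_empty, add_zero, hcJ, not_false_eq_true, true_and]
    constructor
    · rintro (h | ⟨y, hy, h⟩)
      · exact ⟨T, subset_rfl, ∅, by simp, by simp, by simpa⟩
      · refine ⟨T \ {y}, sdiff_subset, {c}, subset_rfl, ?_, ?_⟩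
        · rw [ncard_singleton, ncard_sdiff_singleton_add_one hy hTfin]
        · rwa [union_singleton, insert_union]
    · rintro ⟨T₁, hT₁, C, hC, hcard, h⟩
      obtain rfl | rfl := subset_singleton_iff_eq.1 hC
      · rw [ncard_empty, add_zero] at hcard
        obtain rfl := eq_of_subset_of_ncard_le hT₁ hcard.ge hTfin
        exact Or.inl (by simpa using h)
      · rw [ncard_singleton] at hcard
        obtain ⟨y, hyT, hy⟩ := exists_mem_notMem_of_ncard_lt_ncard (s := T₁) (t := T) (by lia)
          (hTfin.subset hT₁)
        have hsub : T₁ ⊆ T \ {y} := subset_sdiff_singleton hT₁ hy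
        have := ncard_sdiff_singleton_add_one hyT hTfin
        obtain rfl := eq_of_subset_of_ncard_le hsub (by lia) hTfin.sdiff
        refine Or.inr ⟨y, hyT, ?_⟩
        rwa [union_singleton, insert_union] at h
  · simp only [mem_union, mem_singleton_iff, or_true, not_true_eq_false, false_and, and_false,
      exists_false, or_false, ncard_singleton]
    constructor
    · exact fun h ↦ ⟨T, subset_rfl, {c}, subset_rfl, by simp, h⟩
    · rintro ⟨T₁, hT₁, C, hC, hcard, h⟩
      have h1 := ncard_le_ncard hC
      have h2 := ncard_le_ncard hT₁ hTfin
      rw [ncard_singleton] at h1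
      obtain rfl := eq_of_subset_of_ncard_le hC (by rw [ncard_singleton]; lia)
      obtain rfl := eq_of_subset_of_ncard_le hT₁ (by lia) hTfin
      exact h

end Construction

/-! ### Independence after placing `a` and `b` -/

section Construction

variable {α β : Type*}

@[simp] lemma ofSum_inl (x : β) : (Elt.ofSum : β ⊕ α ↪ Elt α β) (Sum.inl x) = Elt.ofN x := rfl

@[simp] lemma ofSum_inr (x : α) : (Elt.ofSum : β ⊕ α ↪ Elt α β) (Sum.inr x) = Elt.ofL x := rfl

lemma sum_mapEmbedding_indep_iff {L : Matroid α} {N : Matroid β} {X : Set α} {Q : Set β} :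
    ((N.sum L).mapEmbedding Elt.ofSum).Indep (Elt.ofL '' X ∪ Elt.ofN '' Q) ↔
      L.Indep X ∧ N.Indep Q := by
  have h1 : Sum.inl ⁻¹' (Elt.ofSum ⁻¹' (Elt.ofL '' X ∪ Elt.ofN '' Q)) = Q := by
    ext x; simp
  have h2 : Sum.inr ⁻¹' (Elt.ofSum ⁻¹' (Elt.ofL '' X ∪ Elt.ofN '' Q)) = X := by
    ext x; simp
  have h3 : Elt.ofL '' X ∪ Elt.ofN '' Q ⊆ range (Elt.ofSum : β ⊕ α ↪ Elt α β) := by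
    rintro _ (⟨x, -, rfl⟩ | ⟨x, -, rfl⟩)
    · exact ⟨Sum.inr x, rfl⟩
    · exact ⟨Sum.inl x, rfl⟩
  rw [mapEmbedding_indep_iff, sum_indep_iff, h1, h2, and_iff_left h3, and_comm]

lemma sum_mapEmbedding_ground {L : Matroid α} {N : Matroid β} :
    ((N.sum L).mapEmbedding Elt.ofSum).E = Elt.ofL '' L.E ∪ Elt.ofN '' N.E := by
  ext x
  cases x <;> simp

/-- Since `a` and `b` may be replaced by any element of `N`, the choice of that element is
immaterial: only the room left in a base counts. -/
lemma exists_insert_indep_iff {N : Matroid β} {A : Set β} (hA : N.IsBase A) (hAfin : A.Finite)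
    {Q : Set β} : (∃ s ∈ N.E, s ∉ Q ∧ N.Indep (insert s Q)) ↔
      N.Indep Q ∧ Q.ncard + 1 ≤ A.ncard := by
  have : N.RankFinite := hA.rankFinite_of_finite hAfin
  constructor
  · rintro ⟨s, -, hsQ, h⟩
    refine ⟨h.subset (subset_insert _ _), ?_⟩
    obtain ⟨B, hB, hsub⟩ := h.exists_isBase_superset
    have hle := ncard_le_ncard hsub hB.finite
    rwa [ncard_insert_of_notMem hsQ (h.finite.subset (subset_insert _ _)),
      hB.ncard_eq_ncard_of_isBase hA] at hle
  · rintro ⟨hQ, hle⟩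
    obtain ⟨B, hB, hsub⟩ := hQ.exists_isBase_superset
    rw [hA.ncard_eq_ncard_of_isBase hB] at hle
    obtain ⟨s, hsB, hsQ⟩ := exists_mem_notMem_of_ncard_lt_ncard (s := Q) (t := B) (by lia) hQ.finite
    exact ⟨s, hB.subset_ground hsB, hsQ, hB.indep.subset (insert_subset hsB hsub)⟩

lemma Indep.ncard_le_of_isBase {N : Matroid β} {A : Set β} (hA : N.IsBase A) (hAfin : A.Finite)
    {Q : Set β} (hQ : N.Indep Q) : Q.ncard ≤ A.ncard := by
  have : N.RankFinite := hA.rankFinite_of_finite hAfin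
  obtain ⟨B, hB, hsub⟩ := hQ.exists_isBase_superset
  rw [hA.ncard_eq_ncard_of_isBase hB]
  exact ncard_le_ncard hsub hB.finite

/-- The matroid obtained from `N ⊕ L` by freely placing `a` and `b` in the flats spanned by
`E(N) ∪ {p}` and `E(N) ∪ {q}`. -/
noncomputable def placeApexes (L : Matroid α) (p q : α) (N : Matroid β) : Matroid (Elt α β) :=
  (((N.sum L).mapEmbedding Elt.ofSum).placeFreely
    (insert (Elt.ofL p) (Elt.ofN '' N.E)) Elt.a).placeFreely
    (insert (Elt.ofL q) (Elt.ofN '' N.E)) Elt.b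

lemma placeApexes_ground {L : Matroid α} {p q : α} {N : Matroid β} :
    (placeApexes L p q N).E = {Elt.a, Elt.b} ∪ (Elt.ofL '' L.E ∪ Elt.ofN '' N.E) := by
  rw [placeApexes, placeFreely_ground, placeFreely_ground, sum_mapEmbedding_ground,
    insert_comm, insert_union, singleton_union]

/-- `P` records which of the apexes `a`, `b` are replaced by `p`, `q`. The other apexes present need
spare elements of `N`, which gives the inequality. -/
lemma placeApexes_indep_iff {L : Matroid α} {p q : α} {N : Matroid β} {A : Set β}
    (hA : N.IsBase A) (hAfin : A.Finite) (hp : p ∈ L.E) (hq : q ∈ L.E) (hpq : p ≠ q)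
    {X : Set α} {Q : Set β} (hpX : p ∉ X) (hqX : q ∉ X) {C D : Set (Elt α β)}
    (hC : C ⊆ {Elt.a}) (hD : D ⊆ {Elt.b}) :
    (placeApexes L p q N).Indep (Elt.ofL '' X ∪ Elt.ofN '' Q ∪ C ∪ D) ↔ ∃ P ⊆ {p, q},
      (p ∈ P → C.ncard = 1) ∧ (q ∈ P → D.ncard = 1) ∧ L.Indep (X ∪ P) ∧ N.Indep Q ∧
      Q.ncard + C.ncard + D.ncard ≤ A.ncard + P.ncard := by
  have : N.RankFinite := hA.rankFinite_of_finite hAfin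
  set M₀ := (N.sum L).mapEmbedding (Elt.ofSum : β ⊕ α ↪ Elt α β) with hM₀
  set M₁ := M₀.placeFreely (insert (Elt.ofL p) (Elt.ofN '' N.E)) Elt.a with hM₁
  have hE : M₀.E = _ := sum_mapEmbedding_ground
  have haM : Elt.a ∉ M₀.E := by simp [hE]
  have hbM : Elt.b ∉ M₁.E := by simp [hM₁, hE]
  have hS₀ : insert (Elt.ofL p) (Elt.ofN '' N.E) ⊆ M₀.E := by
    rw [hE]
    exact insert_subset (Or.inl ⟨p, hp, rfl⟩) subset_union_right
  have hS₁ : insert (Elt.ofL q) (Elt.ofN '' N.E) ⊆ M₁.E := by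
    rw [hM₁, placeFreely_ground, hE]
    exact insert_subset (Or.inr (Or.inl ⟨q, hq, rfl⟩))
      (subset_union_right.trans (subset_insert _ _))
  have hi₀ : ∀ (X : Set α) (Q : Set β), M₀.Indep (Elt.ofL '' X ∪ Elt.ofN '' Q) ↔
      L.Indep X ∧ N.Indep Q := fun _ _ ↦ sum_mapEmbedding_indep_iff
  have hi₁ : ∀ (X : Set α) (Q : Set β), M₁.Indep (Elt.ofL '' X ∪ Elt.ofN '' Q) ↔
      L.Indep X ∧ N.Indep Q := fun X Q ↦ by
    rw [hM₁, placeFreely_indep_iff_of_notMem haM (by simp), hi₀]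
  have hinsL : ∀ (s : α) (X : Set α) (Q : Set β), insert (Elt.ofL s)
      (Elt.ofL '' X ∪ Elt.ofN '' Q) = Elt.ofL '' (insert s X) ∪ Elt.ofN '' Q := fun s X Q ↦ by
    rw [image_insert_eq, insert_union]
  have hinsN : ∀ (s : β) (X : Set α) (Q : Set β), insert (Elt.ofN s)
      (Elt.ofL '' X ∪ Elt.ofN '' Q) = Elt.ofL '' X ∪ Elt.ofN '' (insert s Q) := fun s X Q ↦ by
    rw [image_insert_eq, union_insert]
  have hex := fun Q : Set β ↦ exists_insert_indep_iff hA hAfin (Q := Q)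
  have ha₁ : ∀ (X : Set α) (Q : Set β), p ∉ X →
      (M₁.Indep (insert Elt.a (Elt.ofL '' X ∪ Elt.ofN '' Q)) ↔
      (L.Indep (insert p X) ∧ N.Indep Q) ∨
        (L.Indep X ∧ N.Indep Q ∧ Q.ncard + 1 ≤ A.ncard)) := fun X Q hpX ↦ by
    rw [hM₁, placeFreely_indep_insert_iff haM hS₀ (by simp), ← hex]
    have h1 : Elt.ofL p ∉ Elt.ofL '' X ∪ (Elt.ofN '' Q : Set (Elt α β)) := by simp [hpX]
    have h2 : ∀ s, Elt.ofN s ∉ Elt.ofL '' X ∪ Elt.ofN '' Q ↔ s ∉ Q := by simp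
    have h3 : ∀ (c : Prop), (∃ s ∈ N.E, s ∉ Q ∧ c ∧ N.Indep (insert s Q)) ↔
        c ∧ ∃ s ∈ N.E, s ∉ Q ∧ N.Indep (insert s Q) := fun c ↦ by by_cases c <;> simp_all
    simp only [mem_insert_iff, exists_eq_or_imp, hinsL, hi₀, exists_mem_image, hinsN, h1, h2, h3,
      not_false_eq_true, true_and]
  have hb₁ : ∀ (X : Set α) (Q : Set β), q ∉ X →
      ((placeApexes L p q N).Indep (insert Elt.b (Elt.ofL '' X ∪ Elt.ofN '' Q)) ↔
      (L.Indep (insert q X) ∧ N.Indep Q) ∨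
        (L.Indep X ∧ N.Indep Q ∧ Q.ncard + 1 ≤ A.ncard)) := fun X Q hqX ↦ by
    rw [placeApexes, ← hM₀, ← hM₁, placeFreely_indep_insert_iff hbM hS₁ (by simp), ← hex]
    have h1 : Elt.ofL q ∉ Elt.ofL '' X ∪ (Elt.ofN '' Q : Set (Elt α β)) := by simp [hqX]
    have h2 : ∀ s, Elt.ofN s ∉ Elt.ofL '' X ∪ Elt.ofN '' Q ↔ s ∉ Q := by simp
    have h3 : ∀ (c : Prop), (∃ s ∈ N.E, s ∉ Q ∧ c ∧ N.Indep (insert s Q)) ↔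
        c ∧ ∃ s ∈ N.E, s ∉ Q ∧ N.Indep (insert s Q) := fun c ↦ by by_cases c <;> simp_all
    simp only [mem_insert_iff, exists_eq_or_imp, hinsL, hi₁, exists_mem_image, hinsN, h1, h2, h3,
      not_false_eq_true, true_and]
  have hab : (placeApexes L p q N).Indep
      (insert Elt.b (insert Elt.a (Elt.ofL '' X ∪ Elt.ofN '' Q))) ↔
      (L.Indep (insert p (insert q X)) ∧ N.Indep Q) ∨
      (L.Indep (insert q X) ∧ N.Indep Q ∧ Q.ncard + 1 ≤ A.ncard) ∨
      (L.Indep (insert p X) ∧ N.Indep Q ∧ Q.ncard + 1 ≤ A.ncard) ∨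
      (L.Indep X ∧ N.Indep Q ∧ Q.ncard + 2 ≤ A.ncard) := by
    rw [placeApexes, ← hM₀, ← hM₁, placeFreely_indep_insert_iff hbM hS₁ (by simp)]
    -- The case where `b` and `a` both go into `N`: after `b` is replaced by `s`, one more place
    -- must be left for `a`.
    have hcount : (∃ s ∈ N.E, s ∉ Q ∧ N.Indep (insert s Q) ∧ (insert s Q).ncard + 1 ≤ A.ncard) ↔
        N.Indep Q ∧ Q.ncard + 2 ≤ A.ncard := by
      constructor
      · rintro ⟨s, -, hs, h, hle⟩
        rw [ncard_insert_of_notMem hs (h.subset (subset_insert _ _)).finite] at hle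
        exact ⟨h.subset (subset_insert _ _), hle⟩
      · rintro ⟨h, hle⟩
        obtain ⟨s, hs, hsQ, hsi⟩ := (hex Q).2 ⟨h, by lia⟩
        refine ⟨s, hs, hsQ, hsi, ?_⟩
        rw [ncard_insert_of_notMem hsQ h.finite]
        exact hle
    have hpq' : p ∉ insert q X := by simp [hpq, hpX]
    have hdist : ∀ (c d : Prop) (φ : β → Prop), (∃ s ∈ N.E, s ∉ Q ∧ (c ∧ N.Indep (insert s Q) ∨
        d ∧ N.Indep (insert s Q) ∧ φ s)) ↔ (c ∧ ∃ s ∈ N.E, s ∉ Q ∧ N.Indep (insert s Q)) ∨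
        (d ∧ ∃ s ∈ N.E, s ∉ Q ∧ N.Indep (insert s Q) ∧ φ s) := by
      clear hex hcount
      intro c d φ
      by_cases c <;> by_cases d <;> simp_all only [true_and, false_and, or_false, false_or,
        and_false, exists_false]
      constructor
      · rintro ⟨s, h1, h2, h | h⟩
        exacts [Or.inl ⟨s, h1, h2, h⟩, Or.inr ⟨s, h1, h2, h⟩]
      · rintro (⟨s, h1, h2, h⟩ | ⟨s, h1, h2, h⟩)
        exacts [⟨s, h1, h2, Or.inl h⟩, ⟨s, h1, h2, Or.inr h⟩]
    have hqK : Elt.ofL q ∉ insert Elt.a (Elt.ofL '' X ∪ Elt.ofN '' Q) := by simp [hqX]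
    have hsK : ∀ s, Elt.ofN s ∉ insert Elt.a (Elt.ofL '' X ∪ Elt.ofN '' Q) ↔ s ∉ Q := by simp
    rw [← hcount]
    simp only [mem_insert_iff (s := Elt.ofN '' N.E), exists_eq_or_imp, insert_comm _ Elt.a, hinsL,
      exists_mem_image, hinsN, ha₁ _ _ hpX, ha₁ _ _ hpq', hqK, hsK, not_false_eq_true, true_and,
      hdist, hex Q, or_assoc]
  have hQ : N.Indep Q → Q.ncard ≤ A.ncard := fun h ↦ h.ncard_le_of_isBase hA hAfin
  have hP : ∀ Φ : Set α → Prop, (∃ P ⊆ {p, q}, Φ P) ↔ Φ ∅ ∨ Φ {p} ∨ Φ {q} ∨ Φ {p, q} := fun Φ ↦ by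
    simp only [subset_pair_iff_eq, or_and_right, exists_or, exists_eq_left]
  have hX2 : X ∪ {p, q} = insert p (insert q X) := by
    rw [union_comm, insert_union, singleton_union]
  have hi₂ : (placeApexes L p q N).Indep (Elt.ofL '' X ∪ Elt.ofN '' Q) ↔ L.Indep X ∧ N.Indep Q := by
    rw [placeApexes, ← hM₀, ← hM₁, placeFreely_indep_iff_of_notMem hbM (by simp), hi₁]
  have ha₂ : (placeApexes L p q N).Indep (insert Elt.a (Elt.ofL '' X ∪ Elt.ofN '' Q)) ↔
      (L.Indep (insert p X) ∧ N.Indep Q) ∨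
        (L.Indep X ∧ N.Indep Q ∧ Q.ncard + 1 ≤ A.ncard) := by
    rw [placeApexes, ← hM₀, ← hM₁, placeFreely_indep_iff_of_notMem hbM (by simp), ha₁ X Q hpX]
  have hmono : ∀ x, L.Indep (insert x X) → L.Indep X := fun x h ↦ h.subset (subset_insert _ _)
  rw [hP]
  simp only [mem_empty_iff_false, mem_singleton_iff, mem_insert_iff, hpq, hpq.symm, union_empty,
    union_singleton, hX2, ncard_empty, ncard_singleton, ncard_pair hpq, false_imp_iff, true_imp_iff,
    true_and, or_true, true_or]
  obtain rfl | rfl := subset_singleton_iff_eq.1 hC <;>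
    obtain rfl | rfl := subset_singleton_iff_eq.1 hD
  · simp only [union_empty, ncard_empty, hi₂]
    clear hex hP
    grind
  · simp only [union_empty, union_singleton, ncard_empty, ncard_singleton, hb₁ X Q hqX]
    clear hex hP hi₁ hi₀ ha₁ hb₁ hinsL hinsN
    grind
  · simp only [union_empty, union_singleton, ncard_empty, ncard_singleton, ha₂]
    clear hex hP hi₁ hi₀ ha₁ hb₁ hinsL hinsN
    grind
  · simp only [union_singleton, ncard_singleton, hab]
    clear hex hP hi₁ hi₀ ha₁ hb₁ hinsL hinsN
    have h1 : L.Indep (insert p (insert q X)) → L.Indep (insert q X) :=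
      fun h ↦ h.subset (subset_insert _ _)
    grind

end Construction

/-! ### The independence criterion for the whole construction -/

section Construction

variable {α β : Type*}

/-- Independence in `M(L, p, q; N, A, B)` of a set with parts `X ⊆ E(L)`, `A₀ ⊆ A` and `B₀ ⊆ B`,
where `m` (resp. `n`) is the number of elements in `A₀` (resp. `B₀`) or equal to `a` (resp. `b`),
and `r` is the rank of `N`. -/
def SplitIndep (L : Matroid α) (p q : α) (N : Matroid β) (r : ℕ) (A₀ B₀ : Set β) (X : Set α)
    (m n : ℕ) : Prop :=
  ∃ A₁ ⊆ A₀, ∃ B₁ ⊆ B₀, ∃ P ⊆ {p, q}, N.Indep (A₁ ∪ B₁) ∧ L.Indep (X ∪ P) ∧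
    m ≤ A₁.ncard + 1 ∧ n ≤ B₁.ncard + 1 ∧ (p ∈ P → m = A₁.ncard + 1) ∧
    (q ∈ P → n = B₁.ncard + 1) ∧ m + n ≤ r + P.ncard

/-- The construction places `a` and `A` before `b` and `B`, but its criterion is symmetric.
Statements about one side thereby transfer to the other. -/
lemma SplitIndep.symm {L : Matroid α} {p q : α} {N : Matroid β} {r : ℕ} {A₀ B₀ : Set β}
    {X : Set α} {m n : ℕ} (h : L.SplitIndep p q N r A₀ B₀ X m n) :
    L.SplitIndep q p N r B₀ A₀ X n m := by
  obtain ⟨A₁, hA, B₁, hB, P, hP, h1, h2, h3, h4, h5, h6, h7⟩ := h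
  exact ⟨B₁, hB, A₁, hA, P, by rwa [pair_comm], by rwa [union_comm], h2, h4, h3, h6, h5, by lia⟩

lemma splitIndep_comm {L : Matroid α} {p q : α} {N : Matroid β} {r : ℕ} {A₀ B₀ : Set β}
    {X : Set α} {m n : ℕ} :
    L.SplitIndep p q N r A₀ B₀ X m n ↔ L.SplitIndep q p N r B₀ A₀ X n m :=
  ⟨SplitIndep.symm, SplitIndep.symm⟩

lemma construction_ground {L : Matroid α} {p q : α} {N : Matroid β} {A B : Set β}
    (hunion : A ∪ B = N.E) {lA lB : List β} (hlA : ∀ x, x ∈ lA ↔ x ∈ A)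
    (hlB : ∀ x, x ∈ lB ↔ x ∈ B) : (construction L p q N lA lB).E =
      Elt.ofL '' (L.E \ {p, q}) ∪ Elt.ofN '' N.E ∪ {Elt.a, Elt.b} := by
  have h1 : (construction₁ L p q N lA lB).E =
      {Elt.a, Elt.b} ∪ (Elt.ofL '' L.E ∪ Elt.ofN '' N.E) ∪ Elt.lift '' N.E := by
    change (placeLifts (placeLifts (placeApexes L p q N) Elt.a lA) Elt.b lB).E = _
    rw [placeLifts_ground, placeLifts_ground, placeApexes_ground, union_assoc, ← image_union,
      ← hunion]
    simp only [hlA, hlB, ofPred_mem_eq]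
  rw [construction, delete_ground, construction₂, mapEquiv_ground_eq, delete_ground, h1]
  ext x
  simp only [mem_sdiff, mem_image_equiv]
  rcases x with x | x | _ | _ | x <;> simp [Elt.swapLift]

/-- The criteria for the lifts of `B`, the lifts of `A` and the apexes are composed, undoing the
placements from last to first. The intermediate sets `C ⊆ {a}` and `D ⊆ {b}` are then eliminated
through their sizes, `m - |A₁|` and `n - |B₁|`. -/
lemma construction_indep_iff {L : Matroid α} {p q : α} {N : Matroid β} {A B : Set β}
    (hp : p ∈ L.E) (hq : q ∈ L.E) (hpq : p ≠ q) (hA : N.IsBase A)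
    (hdisj : Disjoint A B) (hunion : A ∪ B = N.E) {lA lB : List β} (hlA : lA.Nodup)
    (hlA_mem : ∀ x, x ∈ lA ↔ x ∈ A) (hlB : lB.Nodup) (hlB_mem : ∀ x, x ∈ lB ↔ x ∈ B)
    {Z : Set (Elt α β)} (hZ : Z ⊆ (construction L p q N lA lB).E) :
    (construction L p q N lA lB).Indep Z ↔ L.SplitIndep p q N A.ncard (A ∩ Elt.ofN ⁻¹' Z)
      (B ∩ Elt.ofN ⁻¹' Z) (Elt.ofL ⁻¹' Z)
      ((A ∩ Elt.ofN ⁻¹' Z).ncard + (Z ∩ {Elt.a}).ncard)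
      ((B ∩ Elt.ofN ⁻¹' Z).ncard + (Z ∩ {Elt.b}).ncard) := by
  have hAfin : A.Finite := lA.finite_toSet.subset fun x hx ↦ (hlA_mem x).2 hx
  have hBfin : B.Finite := lB.finite_toSet.subset fun x hx ↦ (hlB_mem x).2 hx
  rw [construction_ground hunion hlA_mem hlB_mem] at hZ
  set A₀ := A ∩ Elt.ofN ⁻¹' Z with hA₀
  set B₀ := B ∩ Elt.ofN ⁻¹' Z with hB₀
  set X : Set α := Elt.ofL ⁻¹' Z with hX
  have hA₀A : A₀ ⊆ A := inter_subset_left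
  have hB₀B : B₀ ⊆ B := inter_subset_left
  have hXE : X ⊆ L.E \ {p, q} := fun x hx ↦ by simpa using hZ hx
  have hpX : p ∉ X := fun h ↦ (hXE h).2 (by simp)
  have hqX : q ∉ X := fun h ↦ (hXE h).2 (by simp)
  -- Undoing the relabelling turns every element of `N` in `Z` back into its lift, the originals
  -- having been deleted.
  have hpre : Elt.swapLift.symm '' Z =
      Elt.ofL '' X ∪ (Z ∩ {Elt.a}) ∪ Elt.lift '' A₀ ∪ (Z ∩ {Elt.b}) ∪ Elt.lift '' B₀ := by
    ext x
    rw [mem_image_equiv, Equiv.symm_symm]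
    rcases x with x | x | _ | _ | x
    · simp [Elt.swapLift, hX]
    · simpa [Elt.swapLift] using fun h ↦ by simpa using hZ h
    · simp [Elt.swapLift]
    · simp [Elt.swapLift]
    · have : Elt.ofN x ∈ Z → x ∈ A ∪ B := fun h ↦ by simpa [hunion] using hZ h
      simp only [Elt.swapLift, mem_union, mem_image, mem_inter_iff]
      simp [hA₀, hB₀]
      grind
  have h1 : (construction L p q N lA lB).Indep Z ↔
      (placeLifts (placeLifts (placeApexes L p q N) Elt.a lA) Elt.b lB).Indep
        (Elt.ofL '' X ∪ (Z ∩ {Elt.a}) ∪ Elt.lift '' A₀ ∪ (Z ∩ {Elt.b}) ∪ Elt.lift '' B₀) := by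
    rw [construction, delete_indep_iff, construction₂, mapEquiv_indep_iff, delete_indep_iff, hpre]
    rw [and_iff_left, and_iff_left]
    · rfl
    · rw [disjoint_left]
      rintro _ h ⟨x, -, rfl⟩
      simp at h
    · rw [disjoint_left]
      rintro _ h (rfl | rfl)
      exacts [hpX h, hqX h]
  have hdisj' : ∀ x ∈ B, x ∉ A := fun x hxB hxA ↦ disjoint_left.1 hdisj hxA hxB
  have hAN : A ⊆ N.E := hA.subset_ground
  have hBN : B ⊆ N.E := hunion ▸ subset_union_right
  have hE : ∀ x, Elt.lift x ∉ (placeApexes L p q N).E := by simp [placeApexes_ground]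
  rw [h1, placeLifts_indep_iff hlB
    (fun x hx ↦ by simp [placeLifts_ground, placeApexes_ground, hBN ((hlB_mem x).1 hx)])
    (fun x hx ↦ by
      rw [placeLifts_ground]
      simpa [hE x, hlA_mem] using hdisj' x ((hlB_mem x).1 hx))
    (by simp [placeLifts_ground, placeApexes_ground]) (by simp) (by simp)
    (fun x hx ↦ by
      have := hdisj' x ((hlB_mem x).1 hx)
      simpa using fun h ↦ this (hA₀A h))
    (fun x hx ↦ (hlB_mem x).2 (hB₀B hx)) (by simp) (by simp) inter_subset_right]
  have h2 : ∀ B₁ ⊆ B₀, ∀ D ⊆ ({Elt.b} : Set (Elt α β)), ((placeApexes L p q N).placeLifts Elt.a lA).Indep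
      (Elt.ofL '' X ∪ (Z ∩ {Elt.a}) ∪ Elt.lift '' A₀ ∪ D ∪ Elt.ofN '' B₁) ↔
      ∃ A₁ ⊆ A₀, ∃ C ⊆ ({Elt.a} : Set (Elt α β)), A₁.ncard + C.ncard = A₀.ncard + (Z ∩ {Elt.a}).ncard ∧
        ∃ P ⊆ {p, q}, (p ∈ P → C.ncard = 1) ∧ (q ∈ P → D.ncard = 1) ∧ L.Indep (X ∪ P) ∧
          N.Indep (A₁ ∪ B₁) ∧
          (A₁ ∪ B₁).ncard + C.ncard + D.ncard ≤ A.ncard + P.ncard := by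
    intro B₁ hB₁ D hD
    have hDa : Elt.a ∉ D := fun h ↦ by simpa using hD h
    have hDl : ∀ x, Elt.lift x ∉ D := fun x h ↦ by simpa using hD h
    have hDn : ∀ x, Elt.ofN x ∉ D := fun x h ↦ by simpa using hD h
    have hre : Elt.ofL '' X ∪ (Z ∩ {Elt.a}) ∪ Elt.lift '' A₀ ∪ D ∪ Elt.ofN '' B₁ =
        (Elt.ofL '' X ∪ D ∪ Elt.ofN '' B₁) ∪ (Z ∩ {Elt.a}) ∪ Elt.lift '' A₀ := by
      ac_rfl
    rw [hre, placeLifts_indep_iff hlA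
      (fun x hx ↦ by simp [placeApexes_ground, hAN ((hlA_mem x).1 hx)])
      (fun x _ ↦ hE x) (by simp [placeApexes_ground]) (by simp) (by simp)
      (by simp [hDl]) (fun x hx ↦ (hlA_mem x).2 (hA₀A hx))
      (fun x hx ↦ by simpa [hDn] using fun h ↦ hdisj' x (hB₀B (hB₁ h)) (hA₀A hx))
      (by simp [hDa]) inter_subset_right]
    refine exists_congr fun A₁ ↦ and_congr_right fun _ ↦ exists_congr fun C ↦
      and_congr_right fun hC ↦ and_congr_right fun _ ↦ ?_
    have hre' : Elt.ofL '' X ∪ D ∪ Elt.ofN '' B₁ ∪ C ∪ Elt.ofN '' A₁ =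
        Elt.ofL '' X ∪ Elt.ofN '' (A₁ ∪ B₁) ∪ C ∪ D := by
      rw [image_union]
      ac_rfl
    rw [hre', placeApexes_indep_iff hA hAfin hp hq hpq hpX hqX hC hD]
  have hcard : ∀ A₁ ⊆ A₀, ∀ B₁ ⊆ B₀, (A₁ ∪ B₁).ncard = A₁.ncard + B₁.ncard :=
    fun A₁ h₁ B₁ h₂ ↦ ncard_union_eq
      (hdisj.mono (h₁.trans hA₀A) (h₂.trans hB₀B)) (hAfin.subset (h₁.trans hA₀A))
      (hBfin.subset (h₂.trans hB₀B))
  constructor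
  · rintro ⟨B₁, hB₁, D, hD, hDc, h⟩
    obtain ⟨A₁, hA₁, C, hC, hCc, P, hP, hpP, hqP, hLX, hN, hle⟩ := (h2 B₁ hB₁ D hD).1 h
    have h3 := ncard_le_ncard hC
    have h4 := ncard_le_ncard hD
    rw [ncard_singleton] at h3 h4
    rw [hcard A₁ hA₁ B₁ hB₁] at hle
    exact ⟨A₁, hA₁, B₁, hB₁, P, hP, hN, hLX, by lia, by lia, fun h ↦ by have := hpP h; lia,
      fun h ↦ by have := hqP h; lia, by lia⟩
  · rintro ⟨A₁, hA₁, B₁, hB₁, P, hP, hN, hLX, hm, hn, hpP, hqP, hle⟩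
    have h3 := ncard_le_ncard hA₁ (hAfin.subset hA₀A)
    have h4 := ncard_le_ncard hB₁ (hBfin.subset hB₀B)
    -- The bounds `|A₁| ≤ m ≤ |A₁| + 1` say that `m - |A₁|` is 0 or 1, hence the size of some `C ⊆
    -- {a}`; similarly for `D`.
    have hex : ∀ (c : Elt α β) (i j : ℕ), j ≤ i → i ≤ j + 1 → ∃ C : Set (Elt α β), C ⊆ {c} ∧ j + C.ncard = i := by
      intro c i j h h'
      obtain rfl | rfl : i = j ∨ i = j + 1 := by lia
      exacts [⟨∅, by simp, by simp⟩, ⟨{c}, subset_rfl, by simp⟩]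
    obtain ⟨C, hC, hCc⟩ := hex Elt.a _ _ (by lia) hm
    obtain ⟨D, hD, hDc⟩ := hex Elt.b _ _ (by lia) hn
    refine ⟨B₁, hB₁, D, hD, hDc, (h2 B₁ hB₁ D hD).2 ⟨A₁, hA₁, C, hC, hCc, P, hP,
      fun h ↦ by have := hpP h; lia, fun h ↦ by have := hqP h; lia, hLX, hN, ?_⟩⟩
    rw [hcard A₁ hA₁ B₁ hB₁]
    lia

end Construction

/-! ### Effect on the criterion of moving `p` towards `q`, and of removing an element of `L` -/

section Move

variable {α β : Type*} {M : Matroid α} {a b : α} {X : Set α}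

lemma moveTowards_image_insert (a : α) (haX : a ∉ X) [DecidableEq α] :
    Function.update some a none '' X = some '' X ∧
    Function.update some a none '' (insert a X) = insert none (some '' X) := by
  have h : Function.update some a none '' X = some '' X :=
    image_congr fun x hx ↦ Function.update_of_ne (by rintro rfl; exact haX hx) _ _
  rw [image_insert_eq, h, Function.update_self]
  exact ⟨rfl, rfl⟩

lemma injective_update_some_none (a : α) [DecidableEq α] :
    Function.Injective (Function.update some a none : α → Option α) := by
  intro x y h
  by_cases hx : x = a <;> by_cases hy : y = a <;> simp_all

lemma moveTowards_indep_iff_of_notMem (haX : a ∉ X) :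
    (M.moveTowards a b).Indep X ↔ M.Indep X := by
  classical
  rw [moveTowards, comap_indep_iff, delete_indep_iff, (moveTowards_image_insert a haX).1,
    and_iff_left (injective_update_some_none a).injOn, and_iff_left (by simpa using haX),
    placeFreely_indep_iff_of_notMem (by simp) (by simp), mapEmbedding_indep_iff,
    and_iff_left (by simp)]
  simp [preimage_image_eq _ (Option.some_injective α)]

lemma moveTowards_indep_insert_iff (ha : a ∈ M.E) (hb : b ∈ M.E) (haX : a ∉ X) :
    (M.moveTowards a b).Indep (insert a X) ↔
      M.Indep (insert a X) ∨ (b ∉ X ∧ M.Indep (insert b X)) := by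
  have hi : ∀ s, (M.mapEmbedding Function.Embedding.some).Indep (insert (some s) (some '' X)) ↔
      M.Indep (insert s X) := fun s ↦ by
    rw [← image_insert_eq, mapEmbedding_indep_iff, and_iff_left (by simp)]
    simp [preimage_image_eq _ (Option.some_injective α)]
  classical
  rw [moveTowards, comap_indep_iff, delete_indep_iff, (moveTowards_image_insert a haX).2,
    and_iff_left (injective_update_some_none a).injOn, and_iff_left (by simpa using haX),
    placeFreely_indep_insert_iff (by simp) (by simp [pair_subset_iff, ha, hb]) (by simp)]
  simp only [mem_insert_iff, mem_singleton_iff, exists_eq_or_imp, exists_eq_left, hi,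
    (Option.some_injective α).mem_set_image, haX, not_false_eq_true, true_and]

/-- In `M(L, p, q; N, A, B)`, moving `p` towards `q` in `L` only affects sets that contain all of
`A ∪ {a}` and no element of `B ∪ {b}`. -/
lemma splitIndep_moveTowards_iff {L : Matroid α} {p q : α} {N : Matroid β} {r m n : ℕ}
    {A₀ B₀ : Set β} {X : Set α} (hp : p ∈ L.E) (hq : q ∈ L.E) (hpq : p ≠ q) (hpX : p ∉ X)
    (hqX : q ∉ X) (hB₀ : B₀.Finite) (hn : B₀.ncard ≤ n) (h : m ≤ r ∨ 1 ≤ n) :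
    (L.moveTowards p q).SplitIndep p q N r A₀ B₀ X m n ↔ L.SplitIndep p q N r A₀ B₀ X m n := by
  have h₀ : (L.moveTowards p q).Indep X ↔ L.Indep X := moveTowards_indep_iff_of_notMem hpX
  have h₁ : (L.moveTowards p q).Indep (insert q X) ↔ L.Indep (insert q X) :=
    moveTowards_indep_iff_of_notMem (by simp [hpq, hpX])
  have h₂ : (L.moveTowards p q).Indep (insert p (insert q X)) ↔ L.Indep (insert p (insert q X)) := by
    rw [moveTowards_indep_insert_iff hp hq (by simp [hpq, hpX])]
    simp
  have h₃ : (L.moveTowards p q).Indep (insert p X) ↔ L.Indep (insert p X) ∨ L.Indep (insert q X) := by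
    rw [moveTowards_indep_insert_iff hp hq hpX]
    simp [hqX]
  have hX2 : X ∪ {p, q} = insert p (insert q X) := by
    rw [union_comm, insert_union, singleton_union]
  constructor
  · rintro ⟨A₁, hA₁, B₁, hB₁, P, hP, hN, hL, hm', hn', hpP, hqP, hle⟩
    obtain rfl | rfl | rfl | rfl := subset_pair_iff_eq.1 hP
    · rw [union_empty, h₀] at hL
      exact ⟨A₁, hA₁, B₁, hB₁, ∅, hP, hN, by rwa [union_empty], hm', hn', hpP, hqP, hle⟩
    · rw [union_singleton, h₃] at hL
      obtain hL | hL := hL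
      · exact ⟨A₁, hA₁, B₁, hB₁, {p}, hP, hN, by rwa [union_singleton], hm', hn', hpP, hqP, hle⟩
      -- Here `a` was replaced by `p`, but only `q` extends `X` in `L`. The aim is to have `b`
      -- replaced by `q` instead, or to need neither.
      have hm := hpP rfl
      rw [ncard_singleton] at hle
      by_cases hnB : n = B₁.ncard + 1
      · exact ⟨A₁, hA₁, B₁, hB₁, {q}, by simp, hN, by rwa [union_singleton], hm', hn',
          fun _ ↦ hm, fun _ ↦ hnB, by rwa [ncard_singleton]⟩
      by_cases hlt : m + n ≤ r
      · exact ⟨A₁, hA₁, B₁, hB₁, ∅, by simp, hN,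
          by rw [union_empty]; exact hL.subset (subset_insert _ _), hm', hn', by simp, by simp,
          by simpa⟩
      -- Now `n = |B₁|` and `m + n = r + 1`, so `h` rules out `n = 0`. Dropping some `y` from `B₁`
      -- sends its lift to `b`, which `q` can then replace.
      have hcard := ncard_le_ncard hB₁ hB₀
      obtain ⟨y, hy⟩ : B₁.Nonempty := by
        rw [← ncard_pos (hB₀.subset hB₁)]
        lia
      have hy' := ncard_sdiff_singleton_add_one hy (hB₀.subset hB₁)
      exact ⟨A₁, hA₁, B₁ \ {y}, sdiff_subset.trans hB₁, {q}, by simp,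
        hN.subset (union_subset_union_right _ sdiff_subset), by rwa [union_singleton], hm',
        by lia, fun _ ↦ hm, fun _ ↦ by lia, by rwa [ncard_singleton]⟩
    · rw [union_singleton, h₁] at hL
      exact ⟨A₁, hA₁, B₁, hB₁, {q}, hP, hN, by rwa [union_singleton], hm', hn', hpP, hqP, hle⟩
    · rw [hX2, h₂] at hL
      exact ⟨A₁, hA₁, B₁, hB₁, {p, q}, hP, hN, by rwa [hX2], hm', hn', hpP, hqP, hle⟩
  · rintro ⟨A₁, hA₁, B₁, hB₁, P, hP, hN, hL, hrest⟩
    refine ⟨A₁, hA₁, B₁, hB₁, P, hP, hN, ?_, hrest⟩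
    obtain rfl | rfl | rfl | rfl := subset_pair_iff_eq.1 hP
    · rwa [union_empty, h₀, ← union_empty X]
    · rw [union_singleton] at hL ⊢
      exact h₃.2 (Or.inl hL)
    · rw [union_singleton] at hL ⊢
      exact h₁.2 hL
    · rw [hX2] at hL ⊢
      exact h₂.2 hL

lemma splitIndep_delete_iff {L : Matroid α} {p q : α} {N : Matroid β} {r m n : ℕ}
    {A₀ B₀ : Set β} {X : Set α} {x : α} (hxp : x ≠ p) (hxq : x ≠ q) (hxX : x ∉ X) :
    (L ＼ {x}).SplitIndep p q N r A₀ B₀ X m n ↔ L.SplitIndep p q N r A₀ B₀ X m n := by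
  simp only [SplitIndep]
  refine exists_congr fun A₁ ↦ and_congr_right fun _ ↦ exists_congr fun B₁ ↦
    and_congr_right fun _ ↦ exists_congr fun P ↦ and_congr_right fun hP ↦
    and_congr_right fun _ ↦ and_congr_left fun _ ↦ ?_
  rw [deleteElem_indep_iff, and_iff_left]
  rintro (h | h)
  · exact hxX h
  · rcases hP h with rfl | rfl
    exacts [hxp rfl, hxq rfl]

lemma splitIndep_contract_iff {L : Matroid α} {p q : α} {N : Matroid β} {r m n : ℕ}
    {A₀ B₀ : Set β} {X : Set α} {x : α} (hxp : x ≠ p) (hxq : x ≠ q) (hxX : x ∉ X)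
    (hx : L.Indep {x}) :
    (L ／ {x}).SplitIndep p q N r A₀ B₀ X m n ↔ L.SplitIndep p q N r A₀ B₀ (insert x X) m n := by
  simp only [SplitIndep]
  refine exists_congr fun A₁ ↦ and_congr_right fun _ ↦ exists_congr fun B₁ ↦
    and_congr_right fun _ ↦ exists_congr fun P ↦ and_congr_right fun hP ↦
    and_congr_right fun _ ↦ and_congr_left fun _ ↦ ?_
  rw [hx.contract_indep_iff, union_singleton, insert_union, and_iff_right]
  rw [disjoint_singleton_right]
  rintro (h | h)
  · exact hxX h
  · rcases hP h with rfl | rfl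
    exacts [hxp rfl, hxq rfl]

end Move

/-! ### Representability of the single-element deletions and contractions -/

section Minors

variable {F : Type*} [Field F] {α β : Type*}

lemma RepresentableOver.congr {M M' : Matroid α} (hM' : M'.RepresentableOver F) (hE : M.E ⊆ M'.E)
    (h : ∀ I ⊆ M.E, M.Indep I ↔ M'.Indep I) : M.RepresentableOver F :=
  hM'.of_injOn id (injOn_id _) hE fun I hI ↦ by rw [h I hI, image_id]

lemma finite_placeFreely (M : Matroid α) [M.Finite] (S : Set α) (e : α) :
    (M.placeFreely S e).Finite :=
  ⟨by simpa using M.ground_finite⟩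

lemma representableOver_placeLifts [Infinite F] {M : Matroid (Elt α β)} (hMfin : M.Finite)
    (hM : M.RepresentableOver F) (c : Elt α β) (l : List β) :
    (M.placeLifts c l).Finite ∧ (M.placeLifts c l).RepresentableOver F := by
  induction l generalizing M with
  | nil => exact ⟨hMfin, hM⟩
  | cons x l ih =>
    rw [placeLifts_cons]
    exact ih (finite_placeFreely _ _ _) (hM.placeFreely _ _)

/-- Each step of the construction preserves representability. -/
lemma representableOver_construction [Infinite F] {L : Matroid α} {N : Matroid β} [L.Finite]
    [N.Finite] (hL : L.RepresentableOver F) (hN : N.RepresentableOver F) (p q : α) (lA lB : List β) :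
    (construction L p q N lA lB).RepresentableOver F := by
  have h₀ : ((N.sum L).mapEmbedding (Elt.ofSum : β ⊕ α ↪ Elt α β)).Finite := by
    refine ⟨?_⟩
    rw [sum_mapEmbedding_ground]
    exact (L.ground_finite.image _).union (N.ground_finite.image _)
  have h₁ := finite_placeFreely ((N.sum L).mapEmbedding (Elt.ofSum : β ⊕ α ↪ Elt α β))
    (insert (Elt.ofL p) (Elt.ofN '' N.E)) Elt.a
  have h₂ : (placeApexes L p q N).Finite := finite_placeFreely _ _ _
  have hr : (placeApexes L p q N).RepresentableOver F :=
    (((hN.sum hL).mapEmbedding _).placeFreely _ _).placeFreely _ _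
  obtain ⟨h₃, hr₃⟩ := representableOver_placeLifts h₂ hr Elt.a lA
  exact (((representableOver_placeLifts h₃ hr₃ Elt.b lB).2.delete _).mapEquiv _).delete _

lemma contract_singleton_indep_iff {M : Matroid α} {e : α} {I : Set α} (he : M.Indep {e})
    (heI : e ∉ I) : (M ／ {e}).Indep I ↔ M.Indep (insert e I) := by
  rw [he.contract_indep_iff, union_singleton, and_iff_right (by simpa using heI)]

/-- If `M ＼ {e}` is representable, and the independent sets of `M` containing `e` are those of a
representable matroid `M'`, then `M ／ {e}` is representable. -/
lemma representableOver_contract_of_forall {M M' : Matroid α} {e : α}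
    (hdel : (M ＼ {e}).RepresentableOver F) (hM' : M'.RepresentableOver F) (hE : M.E ⊆ M'.E)
    (heE : e ∈ M.E) (h : ∀ I ⊆ M.E, e ∈ I → (M.Indep I ↔ M'.Indep I)) :
    (M ／ {e}).RepresentableOver F := by
  by_cases he : M.Indep {e}
  · refine (hM'.contract {e}).congr (sdiff_subset_sdiff_left hE) fun I hI ↦ ?_
    obtain ⟨hIE, heI⟩ := subset_sdiff.1 hI
    rw [disjoint_singleton_right] at heI
    rw [contract_singleton_indep_iff he heI, contract_singleton_indep_iff _ heI,
      h _ (insert_subset heE hIE) (mem_insert _ _)]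
    exact (h {e} (by simpa) rfl).1 he
  -- Here `e` is a loop, so contracting it is the same as deleting it.
  · rwa [contract_eq_delete_of_subset_loops]
    rwa [singleton_subset_iff, ← isLoop_iff, ← singleton_dep, dep_iff,
      and_iff_left (by simpa)]

end Minors

section Minors

variable {F : Type*} [Field F] {α β : Type*}

lemma IncomparablePair.ne {M : Matroid α} {p q : α} (h : M.IncomparablePair p q) : p ≠ q := by
  rintro rfl
  obtain ⟨-, -, ⟨Y, -, h1, h2⟩, -⟩ := h
  exact h2 h1

/-- The deletion and contraction of an element of `L` in `M(L, p, q; N, A, B)`. -/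
lemma representableOver_construction_remove_ofL [Infinite F] {L : Matroid α}
    (hL : L.IsExcludedMinorFor F) {p q : α} (hp : p ∈ L.E) (hq : q ∈ L.E) (hpq : p ≠ q) {N : Matroid β} [N.Finite]
    (hN : N.RepresentableOver F) {A B : Set β} (hA : N.IsBase A) (hdisj : Disjoint A B)
    (hunion : A ∪ B = N.E) {lA lB : List β} (hlA : lA.Nodup) (hlA_mem : ∀ x, x ∈ lA ↔ x ∈ A)
    (hlB : lB.Nodup) (hlB_mem : ∀ x, x ∈ lB ↔ x ∈ B) {x : α} (hx : x ∈ L.E) (hxp : x ≠ p)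
    (hxq : x ≠ q) :
    (construction L p q N lA lB ＼ {Elt.ofL x}).RepresentableOver F ∧
      (construction L p q N lA lB ／ {Elt.ofL x}).RepresentableOver F := by
  have hLfin : L.Finite := hL.1
  have hground := fun L' : Matroid α ↦ construction_ground (L := L') (p := p) (q := q)
    hunion hlA_mem hlB_mem
  have hcon : ∀ L' : Matroid α, p ∈ L'.E → q ∈ L'.E → ∀ Z ⊆ (construction L' p q N lA lB).E, _ :=
    fun L' hp hq Z hZ ↦
      construction_indep_iff hp hq hpq hA hdisj hunion hlA hlA_mem hlB hlB_mem hZ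
  have hE : (construction L p q N lA lB).E \ {Elt.ofL x} ⊆ Elt.ofL '' ((L.E \ {x}) \ {p, q}) ∪
      Elt.ofN '' N.E ∪ {Elt.a, Elt.b} := by
    rw [hground]
    rintro _ ⟨(⟨y, hy, rfl⟩ | hy) | hy, hyx⟩
    · exact Or.inl (Or.inl ⟨y, ⟨⟨hy.1, fun h ↦ hyx (congrArg _ h)⟩, hy.2⟩, rfl⟩)
    · exact Or.inl (Or.inr hy)
    · exact Or.inr hy
  have hmin : ∀ L' : Matroid α, L' ≤m L → L'.E = L.E \ {x} → L'.RepresentableOver F := by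
    refine fun L' h h' ↦ hL.2.2 L' (isStrictMinor_iff_isMinor_ne.2 ⟨h, ?_⟩)
    rintro rfl
    exact (h' ▸ hx).2 rfl
  have hdel : (construction L p q N lA lB ＼ {Elt.ofL x}).RepresentableOver F := by
    have h1 : (L ＼ {x}).Finite := ⟨L.ground_finite.subset sdiff_subset⟩
    refine (representableOver_construction (hmin (L ＼ {x}) ⟨∅, {x}, by simp⟩ rfl) hN
      p q lA lB).congr (by rwa [hground]) fun Z hZ ↦ ?_
    have hZ' : Z ⊆ (construction (L ＼ {x}) p q N lA lB).E := hZ.trans (by rwa [hground])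
    obtain ⟨hZE, hxZ⟩ := subset_sdiff.1 hZ
    rw [delete_indep_iff, and_iff_left hxZ, hcon L hp hq Z hZE,
      hcon (L ＼ {x}) ⟨hp, hxp.symm⟩ ⟨hq, hxq.symm⟩ Z hZ', splitIndep_delete_iff hxp hxq]
    simpa using hxZ
  refine ⟨hdel, ?_⟩
  by_cases hxi : (construction L p q N lA lB).Indep {Elt.ofL x}
  swap
  · rwa [contract_eq_delete_of_subset_loops]
    rw [singleton_subset_iff, ← isLoop_iff, ← singleton_dep, dep_iff]
    refine ⟨hxi, ?_⟩
    rw [hground]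
    simp [hx, hxp, hxq]
  have h1 : (L ／ {x}).Finite := ⟨L.ground_finite.subset sdiff_subset⟩
  have hxL : L.Indep {x} := by
    have h2 := (hcon L hp hq _ hxi.subset_ground).1 hxi
    obtain ⟨-, -, -, -, P, -, -, h3, -⟩ := h2
    exact h3.subset fun y hy ↦ Or.inl (by simpa using hy)
  refine (representableOver_construction (hmin (L ／ {x}) ⟨{x}, ∅, by simp⟩ rfl) hN
    p q lA lB).congr (by rwa [hground]) fun Z hZ ↦ ?_
  have hZ' : Z ⊆ (construction (L ／ {x}) p q N lA lB).E := hZ.trans (by rwa [hground])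
  obtain ⟨hZE, hxZ⟩ := subset_sdiff.1 hZ
  rw [disjoint_singleton_right] at hxZ
  have hpre : Elt.ofL ⁻¹' (insert (Elt.ofL x) Z) = insert x (Elt.ofL ⁻¹' Z) := by
    ext y; simp
  have hpre' : (Elt.ofN ⁻¹' (insert (Elt.ofL x) Z) : Set β) = Elt.ofN ⁻¹' Z := by
    ext y; simp
  rw [contract_singleton_indep_iff hxi hxZ,
    hcon L hp hq _ (insert_subset (hxi.subset_ground rfl) hZE),
    hcon (L ／ {x}) ⟨hp, hxp.symm⟩ ⟨hq, hxq.symm⟩ Z hZ', splitIndep_contract_iff hxp hxq hxZ hxL, hpre, hpre',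
    insert_inter_of_notMem (by simp), insert_inter_of_notMem (by simp)]

/-- With `one_le_ncard_split`, this translates the absence or presence of `e` into the numerical
hypothesis of `splitIndep_moveTowards_iff`. -/
lemma ncard_split_le {A : Set β} {c e : Elt α β} {Z : Set (Elt α β)} (hAfin : A.Finite)
    (he : e ∈ Elt.ofN '' A ∪ {c}) (heZ : e ∉ Z) :
    (A ∩ Elt.ofN ⁻¹' Z).ncard + (Z ∩ {c}).ncard ≤ A.ncard := by
  obtain ⟨x, hx, rfl⟩ | rfl := he
  · have h1 : A ∩ Elt.ofN ⁻¹' Z ⊆ A \ {x} := fun y hy ↦ ⟨hy.1, by rintro rfl; exact heZ hy.2⟩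
    have h2 := ncard_le_ncard h1 hAfin.sdiff
    have h3 := ncard_sdiff_singleton_add_one hx hAfin
    have h4 := ncard_le_ncard (inter_subset_right : Z ∩ {c} ⊆ {c})
    rw [ncard_singleton] at h4
    lia
  · rw [inter_singleton_eq_empty.2 heZ, ncard_empty]
    exact ncard_le_ncard inter_subset_left hAfin

lemma one_le_ncard_split {A : Set β} {c e : Elt α β} {Z : Set (Elt α β)} (hAfin : A.Finite)
    (he : e ∈ Elt.ofN '' A ∪ {c}) (heZ : e ∈ Z) :
    1 ≤ (A ∩ Elt.ofN ⁻¹' Z).ncard + (Z ∩ {c}).ncard := by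
  obtain ⟨x, hx, rfl⟩ | rfl := he
  · have := (ncard_pos (hAfin.inter_of_left (Elt.ofN ⁻¹' Z))).2 ⟨x, hx, heZ⟩
    lia
  · rw [inter_eq_right.2 (singleton_subset_iff.2 heZ), ncard_singleton]
    lia

/-- Sets avoiding an element of `A ∪ {a}` do not see `p` moving towards `q`, and sets containing
such an element do not see `q` moving towards `p`. So its deletion is compared with `M₁` and its
contraction with `M₂`; for `B ∪ {b}` the roles are exchanged. -/
lemma representableOver_construction_remove [Infinite F] {L : Matroid α}
    (hL : L.IsExcludedMinorFor F) {p q : α} (hp : p ∈ L.E) (hq : q ∈ L.E) (hpq : p ≠ q)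
    (hLpq : (L.moveTowards p q).RepresentableOver F)
    (hLqp : (L.moveTowards q p).RepresentableOver F) {N : Matroid β} [N.Finite]
    (hN : N.RepresentableOver F) {A B : Set β} (hA : N.IsBase A) (hB : N.IsBase B)
    (hdisj : Disjoint A B)
    (hunion : A ∪ B = N.E) {lA lB : List β} (hlA : lA.Nodup) (hlA_mem : ∀ x, x ∈ lA ↔ x ∈ A)
    (hlB : lB.Nodup) (hlB_mem : ∀ x, x ∈ lB ↔ x ∈ B) {e : Elt α β}
    (he : e ∈ (construction L p q N lA lB).E) :
    (construction L p q N lA lB ＼ {e}).RepresentableOver F ∧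
      (construction L p q N lA lB ／ {e}).RepresentableOver F := by
  have hLfin : L.Finite := hL.1
  have hAfin : A.Finite := N.ground_finite.subset hA.subset_ground
  have hBfin : B.Finite := N.ground_finite.subset hB.subset_ground
  have hAB : B.ncard = A.ncard := hB.ncard_eq_ncard_of_isBase hA
  have hground := fun L' : Matroid α ↦ construction_ground (L := L') (p := p) (q := q)
    hunion hlA_mem hlB_mem
  have hcon : ∀ L' : Matroid α, p ∈ L'.E → q ∈ L'.E → ∀ Z ⊆ (construction L' p q N lA lB).E, _ :=
    fun L' hp hq Z hZ ↦
      construction_indep_iff hp hq hpq hA hdisj hunion hlA hlA_mem hlB hlB_mem hZ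
  set M := construction L p q N lA lB with hM
  by_cases hside : e ∈ Elt.ofN '' A ∪ {Elt.a} ∨ e ∈ Elt.ofN '' B ∪ {Elt.b}
  swap
  · have he' := he
    rw [hM, hground, ← hunion, image_union] at he'
    obtain ⟨x, hx, rfl⟩ : e ∈ Elt.ofL '' (L.E \ {p, q}) := by
      simp only [mem_union, mem_insert_iff, mem_singleton_iff] at he' hside ⊢
      tauto
    exact representableOver_construction_remove_ofL hL hp hq hpq hN hA hdisj hunion hlA hlA_mem
      hlB hlB_mem hx.1 (fun h ↦ hx.2 (Or.inl h)) (fun h ↦ hx.2 (Or.inr h))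
  have hEpq : (L.moveTowards p q).E = L.E := moveTowards_ground L hp
  have hEqp : (L.moveTowards q p).E = L.E := moveTowards_ground L hq
  have hfpq : (L.moveTowards p q).Finite := ⟨hEpq ▸ L.ground_finite⟩
  have hfqp : (L.moveTowards q p).Finite := ⟨hEqp ▸ L.ground_finite⟩
  set M₁ := construction (L.moveTowards p q) p q N lA lB with hM₁
  set M₂ := construction (L.moveTowards q p) p q N lA lB with hM₂
  have hr₁ : M₁.RepresentableOver F := representableOver_construction hLpq hN p q lA lB
  have hr₂ : M₂.RepresentableOver F := representableOver_construction hLqp hN p q lA lB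
  have hE₁ : M₁.E = M.E := by rw [hM₁, hM, hground, hground, hEpq]
  have hE₂ : M₂.E = M.E := by rw [hM₂, hM, hground, hground, hEqp]
  have hpZ : ∀ Z ⊆ M.E, p ∉ Elt.ofL ⁻¹' Z := fun Z hZ h ↦ by simpa [hM, hground] using hZ h
  have hqZ : ∀ Z ⊆ M.E, q ∉ Elt.ofL ⁻¹' Z := fun Z hZ h ↦ by simpa [hM, hground] using hZ h
  have h₁ : ∀ Z ⊆ M.E, (A ∩ Elt.ofN ⁻¹' Z).ncard + (Z ∩ {Elt.a}).ncard ≤ A.ncard ∨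
      1 ≤ (B ∩ Elt.ofN ⁻¹' Z).ncard + (Z ∩ {Elt.b}).ncard → (M.Indep Z ↔ M₁.Indep Z) := by
    intro Z hZ h
    rw [hcon L hp hq Z hZ, hcon (L.moveTowards p q) (hEpq ▸ hp) (hEpq ▸ hq) Z (hE₁ ▸ hZ),
      splitIndep_moveTowards_iff hp hq hpq (hpZ Z hZ) (hqZ Z hZ) (hBfin.inter_of_left _) (by lia) h]
  have h₂ : ∀ Z ⊆ M.E, (B ∩ Elt.ofN ⁻¹' Z).ncard + (Z ∩ {Elt.b}).ncard ≤ A.ncard ∨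
      1 ≤ (A ∩ Elt.ofN ⁻¹' Z).ncard + (Z ∩ {Elt.a}).ncard → (M.Indep Z ↔ M₂.Indep Z) := by
    intro Z hZ h
    rw [hcon L hp hq Z hZ, hcon (L.moveTowards q p) (hEqp ▸ hp) (hEqp ▸ hq) Z (hE₂ ▸ hZ),
      splitIndep_comm, splitIndep_comm (L := L.moveTowards q p),
      splitIndep_moveTowards_iff hq hp hpq.symm (hqZ Z hZ) (hpZ Z hZ) (hAfin.inter_of_left _)
        (by lia) h]
  have hdel : ∀ M' : Matroid (Elt α β), M'.RepresentableOver F → M'.E = M.E →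
      (∀ Z ⊆ M.E, e ∉ Z → (M.Indep Z ↔ M'.Indep Z)) → (M ＼ {e}).RepresentableOver F := by
    refine fun M' hM' hE h ↦ hM'.congr (hE ▸ sdiff_subset) fun Z hZ ↦ ?_
    obtain ⟨hZE, hxZ⟩ := subset_sdiff.1 hZ
    rw [delete_indep_iff, and_iff_left hxZ, h Z hZE (by simpa using hxZ)]
  obtain hside | hside := hside
  · have hd := hdel M₁ hr₁ hE₁ fun Z hZ heZ ↦ h₁ Z hZ (Or.inl (ncard_split_le hAfin hside heZ))
    exact ⟨hd, representableOver_contract_of_forall hd hr₂ hE₂.ge he fun Z hZ heZ ↦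
      h₂ Z hZ (Or.inr (one_le_ncard_split hAfin hside heZ))⟩
  · have hd := hdel M₂ hr₂ hE₂ fun Z hZ heZ ↦
      h₂ Z hZ (Or.inl (hAB ▸ ncard_split_le hBfin hside heZ))
    exact ⟨hd, representableOver_contract_of_forall hd hr₁ hE₁.ge he fun Z hZ heZ ↦
      h₁ Z hZ (Or.inr (one_le_ncard_split hBfin hside heZ))⟩

end Minors

/-! ### Recovering a representation of `L` in a quotient space -/

section Quotient

variable {F : Type*} [Field F] {V : Type*} [AddCommGroup V] [Module F V] {α β : Type*}

/-- A vector of `S` whose image lies in that of `U` is a vector of `S` lying in `W ⊔ U`. The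
redundant conjunct on the right allows both sides to be compared under `Disjoint S W`. -/
lemma disjoint_sup_iff_map_mkQ {S W U : Submodule F V} :
    Disjoint S W ∧ Disjoint (S.map W.mkQ) (U.map W.mkQ) ↔
      Disjoint S (W ⊔ U) ∧ Disjoint S W := by
  rw [and_comm]
  refine and_congr_left fun hSW ↦ ?_
  simp only [Submodule.disjoint_def] at hSW ⊢
  constructor
  · intro h s hs hsWU
    obtain ⟨w, hw, u, hu, rfl⟩ := mem_sup.1 hsWU
    refine hSW _ hs ?_
    rw [← Submodule.Quotient.mk_eq_zero, ← mkQ_apply]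
    refine h _ (mem_map_of_mem hs) ?_
    rw [map_add, mkQ_apply W w, (Submodule.Quotient.mk_eq_zero W).2 hw, zero_add]
    exact mem_map_of_mem hu
  · rintro h _ ⟨s, hs, rfl⟩ ⟨u, hu, hus⟩
    rw [mkQ_apply, mkQ_apply, Submodule.Quotient.eq] at hus
    have h1 : s ∈ W ⊔ U := by
      have := sub_mem (mem_sup_right (S := W) hu) (mem_sup_left (T := U) hus)
      rwa [sub_sub_cancel] at this
    rw [h s hs h1, map_zero]

lemma linearIndepOn_mkQ_iff {W : Submodule F V} {w : α → V} {X : Set α} :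
    LinearIndepOn F (W.mkQ ∘ w) X ↔ LinearIndepOn F w X ∧ Disjoint (span F (w '' X)) W := by
  constructor
  · intro h
    have h' : LinearIndepOn F w X := LinearIndependent.of_comp W.mkQ h
    refine ⟨h', ?_⟩
    have := Submodule.range_ker_disjoint (f := W.mkQ) (v := fun x : X ↦ w x) h
    rwa [ker_mkQ, ← image_eq_range] at this
  · rintro ⟨h, h'⟩
    refine LinearIndependent.map h (f := W.mkQ) ?_
    rwa [ker_mkQ, ← image_eq_range]

/-- Applied with `T` a nonempty subset of `{p, q}`, where `W ⊔ span F (w '' T)` becomes `UA`, `UB`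
or their sum, this turns independence modulo `W` into disjointness conditions upstairs. -/
lemma linearIndepOn_mkQ_union_iff {W : Submodule F V} {w : α → V} {X T : Set α}
    (hXT : Disjoint X T) (hT : LinearIndepOn F (W.mkQ ∘ w) T) :
    LinearIndepOn F (W.mkQ ∘ w) (X ∪ T) ↔
      LinearIndepOn F w X ∧ Disjoint (span F (w '' X)) (W ⊔ span F (w '' T)) := by
  rw [linearIndepOn_union_iff hXT, and_iff_right hT, linearIndepOn_mkQ_iff, image_comp, image_comp,
    span_image, span_image, and_assoc, disjoint_sup_iff_map_mkQ]
  exact and_congr_right fun _ ↦ and_iff_left_of_imp fun h ↦ h.mono_right le_sup_left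

/-- Vectors for `L`, without the elements of an incomparable pair `p`, `q`, extend to a
representation of `L` modulo `UA ∩ UB`, where `UA` and `UB` are subspaces standing for `p`
and `q`. -/
lemma IncomparablePair.represents_mkQ {L : Matroid α} {p q : α} (hpq : L.IncomparablePair p q)
    {w : α → V} {UA UB UA' : Submodule F V} (hA : UA = UA' ⊔ span F {w p})
    (hpA : w p ∉ UB) (hqB : w q ∈ UB) (hqA : w q ∉ UA) (hAB : UA ≤ UB ⊔ span F {w p})
    (hBA : UB ≤ UA ⊔ span F {w q})
    (h₁ : ∀ X ⊆ L.E \ {p, q}, L.Indep X ↔ LinearIndepOn F w X)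
    (h₂ : ∀ X ⊆ L.E \ {p, q}, L.Indep (insert p X) ↔ LinearIndepOn F w X ∧
      Disjoint (span F (w '' X)) UA)
    (h₃ : ∀ X ⊆ L.E \ {p, q}, L.Indep (insert q X) ↔ LinearIndepOn F w X ∧
      Disjoint (span F (w '' X)) UB)
    (h₄ : ∀ X ⊆ L.E \ {p, q}, L.Indep (insert p (insert q X)) ↔ LinearIndepOn F w X ∧
      Disjoint (span F (w '' X)) (UA ⊔ span F {w q}))
    (h₅ : ∀ X ⊆ L.E \ {p, q}, L.Indep X → Disjoint (span F (w '' X)) UA') :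
    L.Represents F ((UA ⊓ UB).mkQ ∘ w) := by
  have hne := hpq.ne
  obtain ⟨hp, hq, ⟨Y, hY, hpY, hqY⟩, -⟩ := hpq
  set W := UA ⊓ UB with hW
  have hpA' : w p ∈ UA := hA ▸ mem_sup_right (mem_span_singleton_self _)
  -- Modular law: `UA` contains `w p` and lies in `UB ⊔ span F {w p}`. Thus `UA` is a line modulo
  -- `W`.
  have hWA : UA = W ⊔ span F {w p} := by
    refine le_antisymm (fun u hu ↦ ?_) (sup_le inf_le_left (by simpa))
    obtain ⟨s, hs, t, ht, rfl⟩ := mem_sup.1 (hAB hu)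
    have ht' : t ∈ UA := (span_singleton_le_iff_mem _ _).2 hpA' ht
    exact add_mem_sup ⟨by simpa using sub_mem hu ht', hs⟩ ht
  have hWB : UB = W ⊔ span F {w q} := by
    refine le_antisymm (fun u hu ↦ ?_) (sup_le inf_le_right (by simpa))
    obtain ⟨s, hs, t, ht, rfl⟩ := mem_sup.1 (hBA hu)
    have ht' : t ∈ UB := (span_singleton_le_iff_mem _ _).2 hqB ht
    exact add_mem_sup ⟨hs, by simpa using sub_mem hu ht'⟩ ht
  have hWAB : UA ⊔ span F {w q} = W ⊔ span F (w '' {p, q}) := by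
    rw [hWA, image_pair, span_insert, sup_assoc]
  have hip : LinearIndepOn F (W.mkQ ∘ w) {p} := by
    rw [linearIndepOn_singleton_iff]
    simpa using fun h : w p ∈ W ↦ hpA h.2
  have hiq : LinearIndepOn F (W.mkQ ∘ w) {q} := by
    rw [linearIndepOn_singleton_iff]
    simpa using fun h : w q ∈ W ↦ hqA h.1
  have hipq : LinearIndepOn F (W.mkQ ∘ w) {p, q} := by
    rw [pair_comm, linearIndepOn_insert (by simpa using hne.symm), and_iff_right hip]
    rw [image_singleton, mem_span_singleton]
    rintro ⟨c, hc⟩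
    rw [Function.comp_apply, Function.comp_apply, ← map_smul, mkQ_apply, mkQ_apply,
      Submodule.Quotient.eq] at hc
    refine hqA ?_
    have := sub_mem (smul_mem UA c hpA') hc.1
    rwa [sub_sub_cancel] at this
  -- The crucial point: independent sets avoiding `p` and `q` must survive the quotient. Suppose `X`
  -- spans a nonzero `x` in `W`. A set `Y₀` spanning `p` but not `q` spans a nonzero `z` in `UA`
  -- that is not in `UB`. It will follow that `z` is a multiple of `x`, which lies in `UB`.
  have hkey : ∀ X ⊆ L.E \ {p, q}, L.Indep X → Disjoint (span F (w '' X)) W := by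
    intro X hX hXi
    rw [Submodule.disjoint_def]
    by_contra! hcon
    obtain ⟨x, hxX, hxW, hx0⟩ := hcon
    obtain ⟨Y₀, hY₀⟩ := L.exists_isBasis Y (hY.trans sdiff_subset)
    rw [← hY₀.closure_eq_closure] at hpY hqY
    have hY₀E : Y₀ ⊆ L.E \ {p, q} := hY₀.subset.trans hY
    have hpY₀ : p ∉ Y₀ := fun h ↦ (hY₀E h).2 (by simp)
    have h₆ : ¬ L.Indep (insert p Y₀) := by
      rw [hY₀.indep.mem_closure_iff_of_notMem hpY₀] at hpY
      exact hpY.not_indep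
    have h₇ : L.Indep (insert q Y₀) := hY₀.indep.insert_indep_iff.2 (Or.inl ⟨hq, hqY⟩)
    rw [h₃ _ hY₀E] at h₇
    rw [h₂ _ hY₀E, and_iff_right h₇.1, Submodule.disjoint_def] at h₆
    push Not at h₆
    obtain ⟨z, hzY, hzA, hz0⟩ := h₆
    have hzB : z ∉ UB := fun h ↦ hz0 (Submodule.disjoint_def.1 h₇.2 z hzY h)
    obtain ⟨X', hX', hXX'⟩ := hXi.subset_isBasis_of_subset (subset_union_left (t := Y₀))
      ((union_subset hX hY₀E).trans sdiff_subset)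
    have hX'E : X' ⊆ L.E \ {p, q} := hX'.subset.trans (union_subset hX hY₀E)
    have hX'w := (h₁ X' hX'E).1 hX'.indep
    have hY₀X' : span F (w '' Y₀) ≤ span F (w '' X') := by
      rw [span_le]
      rintro _ ⟨y, hy, rfl⟩
      by_cases hyX' : y ∈ X'
      · exact subset_span ⟨y, hyX', rfl⟩
      have hdep := hX'.insert_dep ⟨Or.inr hy, hyX'⟩
      by_contra hcon
      exact hdep.not_indep ((h₁ _ (insert_subset (hY₀E hy) hX'E)).2 (hX'w.insert hcon))
    -- The span of `X'` contains `x` and `z` and meets `UA'` trivially. As `UA` is `UA'` plus a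
    -- single vector, that span meets `UA` in dimension at most one; eliminating `w p` makes this
    -- explicit.
    have hdj := Submodule.disjoint_def.1 (h₅ X' hX'E hX'.indep)
    have hxX' := span_mono (R := F) (image_mono (f := w) hXX') hxX
    have hzX' := hY₀X' hzY
    rw [hA] at hzA
    obtain ⟨s, hs, t, ht, rfl⟩ := mem_sup.1 (hA ▸ hxW.1)
    obtain ⟨s', hs', t', ht', rfl⟩ := mem_sup.1 hzA
    obtain ⟨c, rfl⟩ := mem_span_singleton.1 ht
    obtain ⟨d, rfl⟩ := mem_span_singleton.1 ht'
    have hc : c ≠ 0 := by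
      rintro rfl
      rw [zero_smul, add_zero] at hxX' hx0
      exact hx0 (hdj _ hxX' hs)
    have hcomb : c • (s' + d • w p) - d • (s + c • w p) = c • s' - d • s := by
      module
    have h0 := hdj (c • (s' + d • w p) - d • (s + c • w p))
      (sub_mem (smul_mem _ c hzX') (smul_mem _ d hxX'))
      (hcomb ▸ sub_mem (smul_mem _ c hs') (smul_mem _ d hs))
    rw [sub_eq_zero] at h0
    exact hzB ((smul_mem_iff _ hc).1 (h0 ▸ smul_mem _ d hxW.2))
  intro I hI
  have hXE : I \ {p, q} ⊆ L.E \ {p, q} := sdiff_subset_sdiff_left hI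
  have hdj : ∀ T ⊆ {p, q}, Disjoint (I \ {p, q}) T := fun T hT ↦ disjoint_sdiff_left.mono_right hT
  by_cases hpI : p ∈ I <;> by_cases hqI : q ∈ I
  · have hIe : I = (I \ {p, q}) ∪ {p, q} :=
      (sdiff_union_of_subset (pair_subset hpI hqI)).symm
    have hIe' : I = insert p (insert q (I \ {p, q})) := by
      rw [← singleton_union, ← singleton_union, ← union_assoc, union_comm, singleton_union]
      exact hIe
    conv_rhs => rw [hIe, linearIndepOn_mkQ_union_iff (hdj _ subset_rfl) hipq, ← hWAB]
    conv_lhs => rw [hIe', h₄ _ hXE]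
  · have hIe : I = (I \ {p, q}) ∪ {p} := by ext x; simp; grind
    conv_rhs => rw [hIe, linearIndepOn_mkQ_union_iff (hdj _ (by simp)) hip, image_singleton, ← hWA]
    conv_lhs => rw [hIe, union_singleton, h₂ _ hXE]
  · have hIe : I = (I \ {p, q}) ∪ {q} := by ext x; simp; grind
    conv_rhs => rw [hIe, linearIndepOn_mkQ_union_iff (hdj _ (by simp)) hiq, image_singleton, ← hWB]
    conv_lhs => rw [hIe, union_singleton, h₃ _ hXE]
  · have hIe : I \ {p, q} = I := sdiff_eq_left.2 (by simp [hpI, hqI])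
    rw [hIe] at hXE
    rw [linearIndepOn_mkQ_iff, ← h₁ _ hXE]
    exact (and_iff_left_of_imp (hkey I hXE)).symm

end Quotient

/-! ### The construction is not representable -/

section Nonrepresentable

variable {F : Type*} [Field F] {α β : Type*} {L : Matroid α} {p q : α} {N : Matroid β}
  {A B : Set β}

lemma splitIndep_empty_iff {r : ℕ} {X : Set α} :
    L.SplitIndep p q N r ∅ ∅ X 0 0 ↔ L.Indep X := by
  constructor
  · rintro ⟨-, -, -, -, P, -, -, h, -⟩
    exact h.subset subset_union_left
  · intro h
    exact ⟨∅, subset_rfl, ∅, subset_rfl, ∅, by simp, by simp, by simpa, by simp, by simp, by simp,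
      by simp, by simp⟩

lemma splitIndep_base_of_indep {X : Set α} (hA : N.IsBase A) (hX : L.Indep X) :
    L.SplitIndep p q N A.ncard A ∅ X A.ncard 0 :=
  ⟨A, subset_rfl, ∅, subset_rfl, ∅, by simp, by simpa using hA.indep, by simpa, by simp, by simp,
    by simp, by simp, by simp⟩

/-- The count `m + n = r + 1` forces `P` to be nonempty, and `n = 0` keeps `q` out of it. So `P =
{p}`, and `A ∪ {a}` stands for `p`. -/
lemma splitIndep_base_left_iff {X : Set α} (hA : N.IsBase A) (hpq : p ≠ q) :
    L.SplitIndep p q N A.ncard A ∅ X (A.ncard + 1) 0 ↔ L.Indep (insert p X) := by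
  constructor
  · rintro ⟨A₁, hA₁, B₁, hB₁, P, hP, -, hL, hm, -, -, hqP, hle⟩
    obtain rfl := subset_empty_iff.1 hB₁
    have hP' : P ⊆ {p} := fun x hx ↦ (hP hx).resolve_right (by rintro rfl; simpa using hqP hx)
    obtain rfl | rfl := subset_singleton_iff_eq.1 hP'
    · simp at hle
    · rwa [union_singleton] at hL
  · intro h
    exact ⟨A, subset_rfl, ∅, subset_rfl, {p}, by simp, by simpa using hA.indep,
      by rwa [union_singleton], by simp, by simp, by simp, by simp [hpq.symm], by simp⟩

/-- The count `m + n = r + 2` leaves only `P = {p, q}`. -/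
lemma splitIndep_base_pair_iff {X : Set α} (hA : N.IsBase A) (hpq : p ≠ q) :
    L.SplitIndep p q N A.ncard A ∅ X (A.ncard + 1) 1 ↔ L.Indep (insert p (insert q X)) := by
  have hX2 : X ∪ {p, q} = insert p (insert q X) := by
    rw [union_comm, insert_union, singleton_union]
  constructor
  · rintro ⟨A₁, hA₁, B₁, hB₁, P, hP, -, hL, hm, -, -, hqP, hle⟩
    obtain rfl := eq_of_subset_of_ncard_le hP (by rw [ncard_pair hpq]; lia)
    rwa [hX2] at hL
  · intro h
    exact ⟨A, subset_rfl, ∅, subset_rfl, {p, q}, subset_rfl, by simpa using hA.indep,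
      by rwa [hX2], by simp, by simp, by simp, by simp, by simp [ncard_pair hpq]⟩

/-- A total of `r + 3` exceeds `r + |P|`. This makes `A ∪ {a, b}` span `B`, and symmetrically. -/
lemma not_splitIndep_base {X : Set α} {B₀ : Set β} (hpq : p ≠ q) :
    ¬ L.SplitIndep p q N A.ncard A B₀ X (A.ncard + 1) 2 := by
  rintro ⟨-, -, -, -, P, hP, -, -, -, -, -, -, hle⟩
  have := ncard_le_ncard hP
  rw [ncard_pair hpq] at this
  lia

lemma construction_indep_union_iff
    (hp : p ∈ L.E) (hq : q ∈ L.E) (hpq : p ≠ q) (hA : N.IsBase A)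
    (hdisj : Disjoint A B) (hunion : A ∪ B = N.E) {lA lB : List β} (hlA : lA.Nodup)
    (hlA_mem : ∀ x, x ∈ lA ↔ x ∈ A) (hlB : lB.Nodup) (hlB_mem : ∀ x, x ∈ lB ↔ x ∈ B)
    {A₀ B₀ : Set β} (hA₀ : A₀ ⊆ A) (hB₀ : B₀ ⊆ B) {X : Set α} (hX : X ⊆ L.E \ {p, q})
    {D : Set (Elt α β)} (hD : D ⊆ {Elt.a, Elt.b}) :
    (construction L p q N lA lB).Indep (Elt.ofL '' X ∪ (Elt.ofN '' (A₀ ∪ B₀) ∪ D)) ↔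
      L.SplitIndep p q N A.ncard A₀ B₀ X (A₀.ncard + (D ∩ {Elt.a}).ncard)
        (B₀.ncard + (D ∩ {Elt.b}).ncard) := by
  have hDl : ∀ x, Elt.ofL x ∉ D := fun x h ↦ by simpa using hD h
  have hDn : ∀ x, Elt.ofN x ∉ D := fun x h ↦ by simpa using hD h
  have hZ : Elt.ofL '' X ∪ (Elt.ofN '' (A₀ ∪ B₀) ∪ D) ⊆ (construction L p q N lA lB).E := by
    rw [construction_ground hunion hlA_mem hlB_mem, ← union_assoc, ← hunion]
    exact union_subset_union (union_subset_union (image_mono hX)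
      (image_mono (union_subset_union hA₀ hB₀))) hD
  have h₁ : A ∩ Elt.ofN ⁻¹' (Elt.ofL '' X ∪ (Elt.ofN '' (A₀ ∪ B₀) ∪ D)) = A₀ := by
    ext x
    have h1 := @hA₀ x
    have h2 := fun h : x ∈ B₀ ↦ disjoint_right.1 hdisj (hB₀ h)
    simp [hDn]
    tauto
  have h₂ : B ∩ Elt.ofN ⁻¹' (Elt.ofL '' X ∪ (Elt.ofN '' (A₀ ∪ B₀) ∪ D)) = B₀ := by
    ext x
    have h1 := @hB₀ x
    have h2 := fun h : x ∈ A₀ ↦ disjoint_left.1 hdisj (hA₀ h)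
    simp [hDn]
    tauto
  have h₃ : Elt.ofL ⁻¹' (Elt.ofL '' X ∪ (Elt.ofN '' (A₀ ∪ B₀) ∪ D)) = X := by
    ext x
    simp [hDl]
  have h₄ : ∀ c : Elt α β, c = Elt.a ∨ c = Elt.b →
      (Elt.ofL '' X ∪ (Elt.ofN '' (A₀ ∪ B₀) ∪ D)) ∩ {c} = D ∩ {c} := by
    rintro _ (rfl | rfl) <;> ext x <;> simp <;> grind
  rw [construction_indep_iff hp hq hpq hA hdisj hunion hlA hlA_mem hlB hlB_mem hZ, h₁, h₂, h₃,
    h₄ _ (Or.inl rfl), h₄ _ (Or.inr rfl)]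

/-- This makes `A ∪ {a, b}` and `B ∪ {a, b}` independent in the construction. -/
lemma IncomparablePair.indep_pair (h : L.IncomparablePair p q) : L.Indep {p, q} := by
  obtain ⟨hp, hq, ⟨Y, hY, hpY, hqY⟩, ⟨Y', hY', hqY', hpY'⟩⟩ := h
  have hpi : L.Indep {p} := by
    rw [indep_singleton, ← not_isLoop_iff]
    exact fun h ↦ hpY' (h.mem_closure Y')
  rw [pair_comm, hpi.insert_indep_iff]
  refine Or.inl ⟨hq, fun hqp ↦ hqY ?_⟩
  exact L.closure_subset_closure_of_subset_closure (singleton_subset_iff.2 hpY) hqp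

/-- The criterion is evaluated on sets made of a part of `L` together with all or none of `A` or `B`
and some apexes, plus one extra element for the spanning relations. The outcome is exactly the
hypotheses of `IncomparablePair.represents_mkQ`, with `UA'` the span of `A`. -/
theorem not_representableOver_construction (hL : ¬ L.RepresentableOver F)
    (hpq : L.IncomparablePair p q) (hA : N.IsBase A) (hB : N.IsBase B) (hdisj : Disjoint A B)
    (hunion : A ∪ B = N.E) {lA lB : List β} (hlA : lA.Nodup) (hlA_mem : ∀ x, x ∈ lA ↔ x ∈ A)
    (hlB : lB.Nodup) (hlB_mem : ∀ x, x ∈ lB ↔ x ∈ B) :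
    ¬ (construction L p q N lA lB).RepresentableOver F := by
  rintro ⟨k, v, hv⟩
  have hAfin : A.Finite := lA.finite_toSet.subset fun x hx ↦ (hlA_mem x).2 hx
  have hBfin : B.Finite := lB.finite_toSet.subset fun x hx ↦ (hlB_mem x).2 hx
  have hAB : A.ncard = B.ncard := hA.ncard_eq_ncard_of_isBase hB
  have hne := hpq.ne
  have hpair := hpq.indep_pair
  have hp := hpq.1
  have hq := hpq.2.1
  set M := construction L p q N lA lB with hM
  have hcon : ∀ A₀ ⊆ A, ∀ B₀ ⊆ B, ∀ X ⊆ L.E \ {p, q}, ∀ D ⊆ ({Elt.a, Elt.b} : Set (Elt α β)), _ :=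
    fun A₀ hA₀ B₀ hB₀ X hX D hD ↦
    construction_indep_union_iff hp hq hne hA hdisj hunion hlA hlA_mem hlB hlB_mem hA₀ hB₀ hX hD
  have hground : M.E = _ := construction_ground (p := p) (q := q) hunion hlA_mem hlB_mem
  have haE : Elt.a ∈ M.E := by simp [hground]
  have hbE : Elt.b ∈ M.E := by simp [hground]
  have hAE : Elt.ofN '' A ⊆ M.E := by
    rw [hground, ← hunion, image_union]
    exact fun x hx ↦ Or.inl (Or.inr (Or.inl hx))
  have hBE : Elt.ofN '' B ⊆ M.E := by
    rw [hground, ← hunion, image_union]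
    exact fun x hx ↦ Or.inl (Or.inr (Or.inr hx))
  have hXE : ∀ X ⊆ L.E \ {p, q}, Elt.ofL '' X ⊆ M.E := by
    intro X hX
    rw [hground]
    exact (image_mono hX).trans (subset_union_left.trans subset_union_left)
  have haa : ({Elt.a} ∩ {Elt.b} : Set (Elt α β)) = ∅ := by simp
  have hbb : ({Elt.b} ∩ {Elt.a} : Set (Elt α β)) = ∅ := by simp
  have habA : ({Elt.a, Elt.b} ∩ {Elt.a} : Set (Elt α β)) = {Elt.a} := by ext; simp
  have habB : ({Elt.a, Elt.b} ∩ {Elt.b} : Set (Elt α β)) = {Elt.b} := by ext; simp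
  -- independent sets of the construction
  have i₁ : ∀ X ⊆ L.E \ {p, q}, M.Indep (Elt.ofL '' X) ↔ L.Indep X := fun X hX ↦ by
    have := hcon ∅ (by simp) ∅ (by simp) X hX ∅ (by simp)
    simpa [splitIndep_empty_iff] using this
  have i₂ : ∀ X ⊆ L.E \ {p, q}, M.Indep (Elt.ofL '' X ∪ (Elt.ofN '' A ∪ {Elt.a})) ↔
      L.Indep (insert p X) := fun X hX ↦ by
    have := hcon A subset_rfl ∅ (by simp) X hX {Elt.a} (by simp)
    rwa [union_empty, inter_self, haa, ncard_singleton, ncard_empty, ncard_empty, add_zero,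
      splitIndep_base_left_iff hA hne] at this
  have i₃ : ∀ X ⊆ L.E \ {p, q}, M.Indep (Elt.ofL '' X ∪ (Elt.ofN '' B ∪ {Elt.b})) ↔
      L.Indep (insert q X) := fun X hX ↦ by
    have := hcon ∅ (by simp) B subset_rfl X hX {Elt.b} (by simp)
    rwa [empty_union, inter_self, hbb, ncard_singleton, ncard_empty, ncard_empty, add_zero, hAB,
      splitIndep_comm, splitIndep_base_left_iff hB hne.symm] at this
  have i₄ : ∀ X ⊆ L.E \ {p, q}, M.Indep (Elt.ofL '' X ∪ (Elt.ofN '' A ∪ {Elt.a, Elt.b})) ↔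
      L.Indep (insert p (insert q X)) := fun X hX ↦ by
    have := hcon A subset_rfl ∅ (by simp) X hX {Elt.a, Elt.b} (by simp)
    rwa [union_empty, habA, habB, ncard_singleton, ncard_singleton, ncard_empty, zero_add,
      splitIndep_base_pair_iff hA hne] at this
  have i₅ : M.Indep (Elt.ofN '' B ∪ {Elt.a, Elt.b}) := by
    have := hcon ∅ (by simp) B subset_rfl ∅ (by simp) {Elt.a, Elt.b} (by simp)
    rw [empty_union, habA, habB, ncard_singleton, ncard_singleton, ncard_empty, zero_add, hAB,
      splitIndep_comm, splitIndep_base_pair_iff hB hne.symm, image_empty, empty_union,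
      insert_empty_eq, pair_comm q p] at this
    exact this.2 hpair
  have i₆ : ∀ X ⊆ L.E \ {p, q}, L.Indep X → M.Indep (Elt.ofL '' X ∪ Elt.ofN '' A) :=
    fun X hX hXi ↦ by
    have := hcon A subset_rfl ∅ (by simp) X hX ∅ (by simp)
    simp only [union_empty, empty_inter, ncard_empty, add_zero] at this
    exact this.2 (splitIndep_base_of_indep hA hXi)
  have i₇ : ∀ y ∈ B, ¬ M.Indep (insert (Elt.ofN y) (Elt.ofN '' A ∪ {Elt.a, Elt.b})) :=
    fun y hy ↦ by
    have := hcon A subset_rfl {y} (by simpa) ∅ (by simp) {Elt.a, Elt.b} (by simp)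
    rw [image_empty, empty_union, union_singleton, image_insert_eq, insert_union, habA, habB,
      ncard_singleton, ncard_singleton, ncard_singleton] at this
    exact fun h ↦ not_splitIndep_base hne (this.1 h)
  have i₈ : ∀ x ∈ A, ¬ M.Indep (insert (Elt.ofN x) (Elt.ofN '' B ∪ {Elt.a, Elt.b})) :=
    fun x hx ↦ by
    have := hcon {x} (by simpa) B subset_rfl ∅ (by simp) {Elt.a, Elt.b} (by simp)
    rw [image_empty, empty_union, singleton_union, image_insert_eq, insert_union, habA, habB,
      ncard_singleton, ncard_singleton, ncard_singleton, splitIndep_comm, hAB] at this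
    exact fun h ↦ not_splitIndep_base hne.symm (this.1 h)
  -- the vectors
  classical
  -- The vectors of `a` and `b` take the places of `p` and `q`.
  set f : α → Elt α β := fun x ↦ if x = p then Elt.a else if x = q then Elt.b else Elt.ofL x with hf
  have hfp : f p = Elt.a := by simp [hf]
  have hfq : f q = Elt.b := by simp [hf, hne.symm]
  have hfX : ∀ X ⊆ L.E \ {p, q}, EqOn f Elt.ofL X := by
    intro X hX x hx
    have h1 : x ≠ p := fun h ↦ (hX hx).2 (Or.inl h)
    have h2 : x ≠ q := fun h ↦ (hX hx).2 (Or.inr h)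
    simp [hf, h1, h2]
  have hfim : ∀ X ⊆ L.E \ {p, q}, (v ∘ f) '' X = v '' (Elt.ofL '' X) := fun X hX ↦ by
    rw [image_comp, (hfX X hX).image_eq]
  have hfi : ∀ X ⊆ L.E \ {p, q}, LinearIndepOn F (v ∘ f) X ↔ LinearIndepOn F v (Elt.ofL '' X) := by
    intro X hX
    rw [linearIndepOn_image_iff (fun x _ y _ h ↦ by simpa using h)]
    exact linearIndepOn_congr ((hfX X hX).comp_left (g := v))
  have hunionv : ∀ S ⊆ M.E, ∀ X ⊆ L.E \ {p, q}, (∀ x, Elt.ofL x ∉ S) → M.Indep S →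
      (M.Indep (Elt.ofL '' X ∪ S) ↔ LinearIndepOn F (v ∘ f) X ∧
        Disjoint (span F ((v ∘ f) '' X)) (span F (v '' S))) := by
    intro S hS X hX hSL hSi
    rw [hv _ (union_subset (hXE X hX) hS), linearIndepOn_union_iff, hfi X hX, hfim X hX,
      and_iff_right ((hv S hS).1 hSi)]
    rw [disjoint_left]
    rintro _ ⟨x, -, rfl⟩ h
    exact hSL x h
  have hAi := (i₄ ∅ (by simp)).2 (by simpa)
  rw [image_empty, empty_union] at hAi
  set UA := span F (v '' (Elt.ofN '' A ∪ {Elt.a})) with hUA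
  set UB := span F (v '' (Elt.ofN '' B ∪ {Elt.b})) with hUB
  have hUA' : UA ⊔ span F {v Elt.b} = span F (v '' (Elt.ofN '' A ∪ {Elt.a, Elt.b})) := by
    rw [hUA, ← span_union, ← image_singleton, ← image_union, union_assoc, singleton_union]
  have hUB' : UB ⊔ span F {v Elt.a} = span F (v '' (Elt.ofN '' B ∪ {Elt.a, Elt.b})) := by
    rw [hUB, ← span_union, ← image_singleton, ← image_union, union_assoc, singleton_union,
      pair_comm]
  have hsA : Elt.ofN '' A ∪ {Elt.a, Elt.b} ⊆ M.E := union_subset hAE (pair_subset haE hbE)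
  have hsB : Elt.ofN '' B ∪ {Elt.a, Elt.b} ⊆ M.E := union_subset hBE (pair_subset haE hbE)
  have hAv := (hv _ hsA).1 hAi
  have hBv := (hv _ hsB).1 i₅
  have hins : ∀ S ⊆ M.E, ∀ x ∈ M.E, LinearIndepOn F v S → ¬ M.Indep (insert x S) →
      v x ∈ span F (v '' S) := by
    intro S hS x hx hSv h
    by_contra hcon
    exact h ((hv _ (insert_subset hx hS)).2 (hSv.insert hcon))
  have hrep : L.Represents F ((UA ⊓ UB).mkQ ∘ (v ∘ f)) := by
    refine hpq.represents_mkQ (UA' := span F (v '' (Elt.ofN '' A))) ?_ ?_ ?_ ?_ ?_ ?_ ?_ ?_ ?_ ?_ ?_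
    · rw [hUA, Function.comp_apply, hfp, image_union, span_union, image_singleton]
    · rw [Function.comp_apply, hfp]
      have h1 : (Elt.ofN '' B ∪ {Elt.a, Elt.b} : Set (Elt α β)) =
          insert Elt.a (Elt.ofN '' B ∪ {Elt.b}) := by
        rw [union_insert]
      rw [h1, linearIndepOn_insert (by simp)] at hBv
      exact hBv.2
    · rw [Function.comp_apply, hfq]
      exact subset_span ⟨_, Or.inr rfl, rfl⟩
    · rw [Function.comp_apply, hfq]
      have h1 : (Elt.ofN '' A ∪ {Elt.a, Elt.b} : Set (Elt α β)) =
          insert Elt.b (Elt.ofN '' A ∪ {Elt.a}) := by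
        rw [pair_comm, union_insert]
      rw [h1, linearIndepOn_insert (by simp)] at hAv
      exact hAv.2
    -- By `i₈`, the independent set `B ∪ {a, b}` spans every element of `A`; the next item is the
    -- mirror image.
    · rw [Function.comp_apply, hfp, hUB', hUA, span_le]
      rintro _ ⟨_, ⟨x, hx, rfl⟩ | rfl, rfl⟩
      · exact hins _ hsB _ (hAE ⟨x, hx, rfl⟩) hBv (i₈ x hx)
      · exact subset_span ⟨_, Or.inr (by simp), rfl⟩
    · rw [Function.comp_apply, hfq, hUA', hUB, span_le]
      rintro _ ⟨_, ⟨x, hx, rfl⟩ | rfl, rfl⟩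
      · exact hins _ hsA _ (hBE ⟨x, hx, rfl⟩) hAv (i₇ x hx)
      · exact subset_span ⟨_, Or.inr (by simp), rfl⟩
    · intro X hX
      rw [← i₁ X hX, hv _ (hXE X hX), hfi X hX]
    · intro X hX
      rw [← i₂ X hX, hunionv _ _ X hX (by simp)]
      · exact hAi.subset (union_subset_union_right _ (by simp))
      · exact union_subset hAE (by simpa)
    · intro X hX
      rw [← i₃ X hX, hunionv _ _ X hX (by simp)]
      · exact i₅.subset (union_subset_union_right _ (by simp))
      · exact union_subset hBE (by simpa)
    · intro X hX
      rw [← i₄ X hX, hunionv _ hsA X hX (by simp) hAi, Function.comp_apply, hfq, hUA']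
    · intro X hX hXi
      exact ((hunionv _ hAE X hX (by simp) (hAi.subset subset_union_left)).1 (i₆ X hX hXi)).2
  exact hL hrep.representableOver

end Nonrepresentable

end Matroid

theorem theorem4p1 {F : Type*} [Field F] [Infinite F] {α β : Type*}
    (L : Matroid α) (hL : L.IsExcludedMinorFor F)
    (p q : α) (hpq : L.IncomparablePair p q)
    (hLpq : (L.moveTowards p q).RepresentableOver F)
    (hLqp : (L.moveTowards q p).RepresentableOver F)
    (N : Matroid β) (hN : N.RepresentableOver F)
    (A B : Set β) (hA : N.IsBase A) (hB : N.IsBase B)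
    (hdisj : Disjoint A B) (hunion : A ∪ B = N.E)
    (lA lB : List β) (hlA : lA.Nodup) (hlA_mem : ∀ x, x ∈ lA ↔ x ∈ A)
    (hlB : lB.Nodup) (hlB_mem : ∀ x, x ∈ lB ↔ x ∈ B) :
    (Matroid.construction L p q N lA lB).IsExcludedMinorFor F := by
  have hNE : N.E.Finite := hunion ▸
    (lA.finite_toSet.subset fun x hx ↦ (hlA_mem x).2 hx).union
      (lB.finite_toSet.subset fun x hx ↦ (hlB_mem x).2 hx)
  have hNfin : N.Finite := ⟨hNE⟩
  have hLfin : L.Finite := hL.1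
  refine ⟨⟨?_⟩, Matroid.not_representableOver_construction hL.2.1 hpq hA hB hdisj hunion hlA
    hlA_mem hlB hlB_mem, fun M' hM' ↦ ?_⟩
  · rw [Matroid.construction_ground hunion hlA_mem hlB_mem]
    exact (((L.ground_finite.subset sdiff_subset).image _).union (hNE.image _)).union (toFinite _)
  obtain ⟨e, he, h⟩ := Matroid.isStrictMinor_singleton hM'
  have hrep := Matroid.representableOver_construction_remove hL hpq.1 hpq.2.1 hpq.ne hLpq hLqp hN
    hA hB hdisj hunion hlA hlA_mem hlB hlB_mem he
  exact h.elim hrep.1.of_isMinor hrep.2.of_isMinor
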